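/- Let $N \geq 1$ be an integer and let $\gamma \in \mathbb{R}$. Consider on $\ell^2(\mathbb{Z},\mathbb{C})$ the bounded operator $H_\gamma$ of the linear PT-symmetric defect on $S_N = \{1,\dots,2N\}$ embedded in the infinite lattice, $$(H_\gamma w)_n = w_{n+1} + w_{n-1} + i\gamma(-1)^n \chi_{n\in S_N}\, w_n, \qquad n \in \mathbb{Z}.$$ A complex number $E$ is an eigenvalue if $H_\gamma w = E w$ for some nonzero $w \in \ell^2(\mathbb{Z},\mathbb{C})$; it is an isolated eigenvalue if it is moreover an isolated point of the spectrum of $H_\gamma$. For $1 \leq k \leq N$ put $$\gamma_{N,k} := 2\cos\frac{\pi(2k-1)}{4N}.$$ Then there are functions $E_k$ of $\gamma$ and sets $D_k \subset \mathbb{R}$ ($1 \leq k \leq N$) such that each $D_k$ has at most finitely many points in every compact interval, and the following holds. 1. (Bifurcation and persistence.) $E_k$ is continuous on $\{\gamma : |\gamma| \geq \gamma_{N,k}\}$, $E_k(\gamma) = 0$ (a point of $[-2,2]$) at $|\gamma| = \gamma_{N,k}$, and for every $\gamma$ with $|\gamma| > \gamma_{N,k}$ both $E_k(\gamma)$ and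 $\overline{E_k(\gamma)}$ are isolated eigenvalues of $H_\gamma$. If $|\gamma| > \gamma_{N,k}$ and $\gamma \notin D_k$, they form a pair of non-real complex-conjugate eigenvalues; if $|\gamma| > \gamma_{N,k}$ and $\gamma \in D_k$, the pair coalesces into a real double semi-simple eigenvalue (geometric and algebraic multiplicity both equal to $2$). The exceptional sets $D_k$ may be empty. 2. (The pairs are new.) For $j \neq k$ and $|\gamma| > \max(\gamma_{N,j},\gamma_{N,k})$, the pairs $\{E_j(\gamma),\overline{E_j(\gamma)}\}$ and $\{E_k(\gamma),\overline{E_k(\gamma)}\}$ are disjoint, and for every $\gamma\in\mathbb{R}$ every non-real eigenvalue of $H_\gamma$ is equal to $E_k(\gamma)$ or $\overline{E_k(\gamma)}$ for some $1 \leq k \leq N$ with $|\gamma| > \gamma_{N,k}$. In particular, $H_\gamma$ has no non-real eigenvalues for $$|\gamma| < \tilde{\gamma}_N := \gamma_{N,N} = 2\cos\frac{\pi(2N-1)}{4N}.$$ -/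

import Mathlib

/-- The gain-loss potential `i γ (-1)^n χ_{n ∈ S_N}` on the lattice, where
`S_N = {1, …, 2N}`. -/
noncomputable def defectPotential (N : ℕ) (γ : ℝ) (n : ℤ) : ℂ :=
  if 1 ≤ n ∧ n ≤ 2 * (N : ℤ) then Complex.I * (γ : ℂ) * (-1 : ℂ) ^ n else 0

/-- The expression `w_{n+1} + w_{n-1} + i γ (-1)^n χ_{n ∈ S_N} w_n`. -/
noncomputable def defectExpr (N : ℕ) (γ : ℝ) (w : ℤ → ℂ) (n : ℤ) : ℂ :=
  w (n + 1) + w (n - 1) + defectPotential N γ n * w n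

lemma norm_defectPotential_le (N : ℕ) (γ : ℝ) (n : ℤ) : ‖defectPotential N γ n‖ ≤ |γ| := by
  unfold defectPotential
  split_ifs
  · simp
  · simp

lemma memlp_comp_equiv (σ : ℤ ≃ ℤ) {w : ℤ → ℂ} (hw : Memℓp w 2) :
    Memℓp (fun n => w (σ n)) 2 := by
  have h2 : 0 < (2 : ENNReal).toReal := by norm_num
  rw [memℓp_gen_iff h2] at hw ⊢
  exact (σ.summable_iff (f := fun n => ‖w n‖ ^ (2 : ENNReal).toReal)).2 hw

lemma memlp_potential_mul (N : ℕ) (γ : ℝ) {w : ℤ → ℂ} (hw : Memℓp w 2) :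
    Memℓp (fun n => defectPotential N γ n * w n) 2 := by
  refine (hw.const_mul (𝕜 := ℂ) ((|γ| : ℝ) : ℂ)).mono' fun n => ?_
  have h := mul_le_mul_of_nonneg_right (norm_defectPotential_le N γ n) (norm_nonneg (w n))
  simpa using h

lemma memlp_defectExpr (N : ℕ) (γ : ℝ) {w : ℤ → ℂ} (hw : Memℓp w 2) :
    Memℓp (defectExpr N γ w) 2 :=
  ((memlp_comp_equiv (Equiv.addRight 1) hw).add
    (memlp_comp_equiv (Equiv.subRight 1) hw)).add (memlp_potential_mul N γ hw)

/-- The linear operator `(H w)_n = w_{n+1} + w_{n-1} + i γ (-1)^n χ_{n ∈ S_N} w_n`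
on `ℓ²(ℤ, ℂ)`. -/
noncomputable def defectLinearMap (N : ℕ) (γ : ℝ) :
    lp (fun _ : ℤ => ℂ) 2 →ₗ[ℂ] lp (fun _ : ℤ => ℂ) 2 where
  toFun w := ⟨defectExpr N γ w, memlp_defectExpr N γ (lp.memℓp w)⟩
  map_add' u v := by
    apply lp.ext
    funext n
    simp only [lp.coeFn_add, Pi.add_apply, defectExpr]
    ring
  map_smul' c u := by
    apply lp.ext
    funext n
    simp only [lp.coeFn_smul, Pi.smul_apply, defectExpr, smul_eq_mul, RingHom.id_apply]
    ring

lemma defectLinearMap_apply (N : ℕ) (γ : ℝ) (w : lp (fun _ : ℤ => ℂ) 2) (n : ℤ) :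
    defectLinearMap N γ w n = w (n + 1) + w (n - 1) + defectPotential N γ n * w n := rfl

lemma lp_norm_comp_equiv (σ : ℤ ≃ ℤ) (w : lp (fun _ : ℤ => ℂ) 2) :
    ‖(⟨fun n => w (σ n), memlp_comp_equiv σ (lp.memℓp w)⟩ : lp (fun _ : ℤ => ℂ) 2)‖ = ‖w‖ := by
  have h2 : 0 < (2 : ENNReal).toReal := by norm_num
  rw [lp.norm_eq_tsum_rpow h2, lp.norm_eq_tsum_rpow h2]
  congr 1
  exact σ.tsum_eq (fun n => ‖w n‖ ^ (2 : ENNReal).toReal)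

lemma lp_norm_potential_mul_le (N : ℕ) (γ : ℝ) (w : lp (fun _ : ℤ => ℂ) 2) :
    ‖(⟨fun n => defectPotential N γ n * w n, memlp_potential_mul N γ (lp.memℓp w)⟩ :
      lp (fun _ : ℤ => ℂ) 2)‖ ≤ |γ| * ‖w‖ := by
  have h : ‖((|γ| : ℝ) : ℂ) • w‖ = |γ| * ‖w‖ := by
    rw [norm_smul]
    simp
  rw [← h]
  refine lp.norm_mono (by norm_num) fun n => ?_
  have h := mul_le_mul_of_nonneg_right (norm_defectPotential_le N γ n) (norm_nonneg (w n))
  rw [lp.coeFn_smul, Pi.smul_apply, norm_smul, norm_mul, Complex.norm_real, Real.norm_eq_abs,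
    abs_abs]
  exact h

lemma norm_defectLinearMap_le (N : ℕ) (γ : ℝ) (w : lp (fun _ : ℤ => ℂ) 2) :
    ‖defectLinearMap N γ w‖ ≤ (2 + |γ|) * ‖w‖ := by
  have e : defectLinearMap N γ w =
      (⟨fun n => w (Equiv.addRight (1 : ℤ) n), memlp_comp_equiv _ (lp.memℓp w)⟩ +
        ⟨fun n => w (Equiv.subRight (1 : ℤ) n), memlp_comp_equiv _ (lp.memℓp w)⟩) +
      ⟨fun n => defectPotential N γ n * w n, memlp_potential_mul N γ (lp.memℓp w)⟩ := rfl
  rw [e]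
  refine (norm_add₃_le).trans ?_
  rw [lp_norm_comp_equiv, lp_norm_comp_equiv]
  linarith [lp_norm_potential_mul_le N γ w]

/-- The bounded operator `H_γ` on `ℓ²(ℤ, ℂ)` of the linear stationary equation
`E w_n = w_{n+1} + w_{n-1} + i γ (-1)^n χ_{n ∈ S_N} w_n`. -/
noncomputable def defectOperator (N : ℕ) (γ : ℝ) :
    lp (fun _ : ℤ => ℂ) 2 →L[ℂ] lp (fun _ : ℤ => ℂ) 2 :=
  (defectLinearMap N γ).mkContinuous (2 + |γ|) (norm_defectLinearMap_le N γ)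

/-- `E` is an eigenvalue of `H_γ`: there is a nonzero `w ∈ ℓ²(ℤ, ℂ)` with `H_γ w = E w`. -/
def IsDefectEigenvalue (N : ℕ) (γ : ℝ) (E : ℂ) : Prop :=
  Module.End.HasEigenvalue (defectOperator N γ).toLinearMap E

/-- `E` is an eigenvalue of `H_γ` that is an isolated point of the spectrum of `H_γ`. -/
def IsIsolatedDefectEigenvalue (N : ℕ) (γ : ℝ) (E : ℂ) : Prop :=
  IsDefectEigenvalue N γ E ∧ ∀ᶠ z in nhdsWithin E {E}ᶜ, z ∉ spectrum ℂ (defectOperator N γ)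

/-- `E` is a double semi-simple eigenvalue of `H_γ`: geometric and algebraic
multiplicity are both equal to two. -/
def IsDoubleSemisimple (N : ℕ) (γ : ℝ) (E : ℂ) : Prop :=
  Module.finrank ℂ (Module.End.eigenspace (defectOperator N γ).toLinearMap E) = 2 ∧
  Module.finrank ℂ (Module.End.maxGenEigenspace (defectOperator N γ).toLinearMap E) = 2

/-- The bifurcation values `γ_{N,k} = 2 cos (π (2k - 1) / (4N))`, for `1 ≤ k ≤ N`. -/
noncomputable def gammaNk (N k : ℕ) : ℝ :=
  2 * Real.cos (Real.pi * (2 * (k : ℝ) - 1) / (4 * (N : ℝ)))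

/-- The threshold `γ̃_N = 2 cos (π (2N - 1) / (4N))`. -/
noncomputable def gammaTilde (N : ℕ) : ℝ :=
  2 * Real.cos (Real.pi * (2 * (N : ℝ) - 1) / (4 * (N : ℝ)))

/-! Write a non-real energy as `E = z + z⁻¹` with `‖z‖ < 1`. An `ℓ²` solution is proportional to
powers of `z` on both sides of the defect, and inside it two lattice steps form a transfer matrix of
determinant `1` and trace `2 * t`, where `2 * t + 2 = E ^ 2 + γ ^ 2`. Matching the two ends gives a
Chebyshev equation (`isDefectEigenvalue_iff`). Divided by `T_N(t)` and expanded in partial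
fractions, it becomes `(1 + z ^ 2) * R(y) = 2` with `y = E ^ 2 + γ ^ 2`, where `R` has its poles
exactly at the squares of the bifurcation values, with positive weights
(`isDefectEigenvalue_iff_pole_sum`).

Positivity makes `R` reverse the sign of imaginary parts. The equation demands the opposite unless
`E ^ 2` is real, so non-real eigenvalues are purely imaginary (`sq_eq_neg_of_isDefectEigenvalue`).
For `E ^ 2 = -s` with `s > 0` there remains the real equation `R(γ ^ 2 - s) = 1 + √(1 + 4 / s)`.
Both sides are strictly decreasing in their own arguments, so every gap between consecutive poles
whose lower end is below `γ ^ 2` contains exactly one solution, and no other solutions exist. The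
solution `s` is 1-Lipschitz in `γ ^ 2` and reaches zero at the pole (`branch_continuous`). The pairs
therefore never return to the real axis, and the exceptional sets can be taken empty.

Isolation follows because the non-real spectrum consists of eigenvalues (self-adjoint plus finite
rank), of which there are finitely many. -/

/-! ### Non-real spectrum of a compact perturbation of a self-adjoint operator -/

theorem hasEigenvalue_of_mem_spectrum_add_compact {X : Type*} [NormedAddCommGroup X]
    [InnerProductSpace ℂ X] [CompleteSpace X] {A K : X →L[ℂ] X} (hA : IsSelfAdjoint A)
    (hK : IsCompactOperator K) {z : ℂ} (hz : z.im ≠ 0) (hs : z ∈ spectrum ℂ (A + K)) :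
    Module.End.HasEigenvalue (A + K).toLinearMap z := by
  have hu : IsUnit (algebraMap ℂ (X →L[ℂ] X) z - A) := by
    by_contra h
    exact hz (hA.im_eq_zero_of_mem_spectrum h)
  obtain ⟨u, hu⟩ := hu
  set R : X →L[ℂ] X := ↑u⁻¹ with hR
  -- Factoring out the invertible `z - A` reduces the claim to the Fredholm alternative for the
  -- compact operator `R * K` at the value `1`.
  have hfac : algebraMap ℂ (X →L[ℂ] X) z - (A + K) = u * (1 - R * K) := by
    rw [mul_sub, ← mul_assoc, hR, Units.mul_inv, hu]
    simp [sub_sub]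
  have hRK : IsCompactOperator (R * K : X →L[ℂ] X) := hK.clm_comp R
  rcases IsCompactOperator.hasEigenvalue_or_mem_resolventSet hRK (one_ne_zero (α := ℂ)) with h | h
  · obtain ⟨v, hv⟩ := h.exists_hasEigenvector
    have hv1 : R (K v) = v := by simpa using hv.apply_eq_smul
    have hv2 : (algebraMap ℂ (X →L[ℂ] X) z - (A + K)) v = 0 := by
      rw [hfac]
      simp [hv1]
    refine Module.End.hasEigenvalue_of_hasEigenvector (x := v)
      ⟨Module.End.mem_eigenspace_iff.2 ?_, hv.2⟩
    simp only [sub_apply, sub_eq_zero] at hv2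
    simpa [Algebra.algebraMap_eq_smul_one] using hv2.symm
  · refine absurd ?_ hs
    rw [spectrum.mem_resolventSet_iff] at h
    rw [spectrum.mem_resolventSet_iff, hfac]
    simpa using u.isUnit.mul h

theorem defectPotential_zero (N : ℕ) (n : ℤ) : defectPotential N 0 n = 0 := by
  simp [defectPotential]

theorem defectOperator_apply (N : ℕ) (γ : ℝ) (w : lp (fun _ : ℤ => ℂ) 2) (n : ℤ) :
    defectOperator N γ w n = w (n + 1) + w (n - 1) + defectPotential N γ n * w n := rfl

/-- Without the potential only the two lattice shifts remain, and they are adjoint to each other. -/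
theorem isSelfAdjoint_defectOperator_zero (N : ℕ) : IsSelfAdjoint (defectOperator N 0) := by
  rw [ContinuousLinearMap.isSelfAdjoint_iff_isSymmetric]
  intro v w
  have key : ∀ a b : lp (fun _ : ℤ => ℂ) 2, ∀ σ : ℤ ≃ ℤ,
      Summable fun n => inner ℂ (a (σ n)) (b n) := fun a b σ =>
    lp.summable_inner
      (⟨fun n => a (σ n), memlp_comp_equiv σ (lp.memℓp a)⟩ : lp (fun _ : ℤ => ℂ) 2) b
  have key' : ∀ a b : lp (fun _ : ℤ => ℂ) 2, ∀ σ : ℤ ≃ ℤ,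
      Summable fun n => inner ℂ (a n) (b (σ n)) := fun a b σ =>
    lp.summable_inner a
      (⟨fun n => b (σ n), memlp_comp_equiv σ (lp.memℓp b)⟩ : lp (fun _ : ℤ => ℂ) 2)
  have h1 : ∑' n : ℤ, inner ℂ (v (n + 1)) (w n) = ∑' n : ℤ, inner ℂ (v n) (w (n - 1)) := by
    rw [← (Equiv.addRight (1 : ℤ)).tsum_eq fun n => inner ℂ (v n) (w (n - 1))]
    simp
  have h2 : ∑' n : ℤ, inner ℂ (v (n - 1)) (w n) = ∑' n : ℤ, inner ℂ (v n) (w (n + 1)) := by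
    rw [← (Equiv.subRight (1 : ℤ)).tsum_eq fun n => inner ℂ (v n) (w (n + 1))]
    simp
  calc inner ℂ (defectOperator N 0 v) w
      = ∑' n : ℤ, (inner ℂ (v (n + 1)) (w n) + inner ℂ (v (n - 1)) (w n)) := by
        rw [lp.inner_eq_tsum]
        refine tsum_congr fun n => ?_
        rw [defectOperator_apply, defectPotential_zero, zero_mul, add_zero, inner_add_left]
    _ = ∑' n : ℤ, (inner ℂ (v n) (w (n + 1)) + inner ℂ (v n) (w (n - 1))) := by
        have e1 := (key v w (Equiv.addRight 1)).tsum_add (key v w (Equiv.subRight 1))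
        have e2 := (key' v w (Equiv.addRight 1)).tsum_add (key' v w (Equiv.subRight 1))
        exact e1.trans (((congrArg₂ _ h1 h2).trans (add_comm _ _)).trans e2.symm)
    _ = inner ℂ v (defectOperator N 0 w) := by
        rw [lp.inner_eq_tsum]
        refine tsum_congr fun n => ?_
        rw [defectOperator_apply, defectPotential_zero, zero_mul, add_zero, inner_add_right]

/-- Multiplication by the potential, as a finite sum of rank one operators. -/
noncomputable def potentialOperator (N : ℕ) (γ : ℝ) :
    lp (fun _ : ℤ => ℂ) 2 →L[ℂ] lp (fun _ : ℤ => ℂ) 2 :=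
  ∑ j ∈ Finset.Icc (1 : ℤ) (2 * N), defectPotential N γ j •
    (lp.singleContinuousLinearMap ℂ (fun _ : ℤ => ℂ) 2 j).comp
      (lp.evalCLM ℂ (fun _ : ℤ => ℂ) 2 j)

theorem isCompactOperator_potentialOperator (N : ℕ) (γ : ℝ) :
    IsCompactOperator (potentialOperator N γ) := by
  have h : potentialOperator N γ ∈
      compactOperator (RingHom.id ℂ) (lp (fun _ : ℤ => ℂ) 2) (lp (fun _ : ℤ => ℂ) 2) :=
    Submodule.sum_mem _ fun j _ => Submodule.smul_mem _ _
      ((isCompactOperator_id (E := ℂ)).comp_clm (lp.evalCLM ℂ (fun _ : ℤ => ℂ) 2 j) |>.clm_comp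
        (lp.singleContinuousLinearMap ℂ (fun _ : ℤ => ℂ) 2 j))
  exact h

theorem potentialOperator_apply (N : ℕ) (γ : ℝ) (w : lp (fun _ : ℤ => ℂ) 2) (n : ℤ) :
    potentialOperator N γ w n = defectPotential N γ n * w n := by
  have h : potentialOperator N γ w =
      ∑ j ∈ Finset.Icc (1 : ℤ) (2 * N), defectPotential N γ j • lp.single 2 j (w j) := by
    simp [potentialOperator, lp.evalCLM]
  rw [h, lp.coeFn_sum, Finset.sum_apply]
  simp only [lp.coeFn_smul, Pi.smul_apply, lp.coeFn_single, smul_eq_mul, Pi.single_apply]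
  by_cases hn : n ∈ Finset.Icc (1 : ℤ) (2 * N)
  · rw [Finset.sum_eq_single_of_mem n hn (by intro b _ hb; simp [hb.symm])]
    simp
  · rw [Finset.sum_eq_zero]
    · have : defectPotential N γ n = 0 := if_neg (by simpa using hn)
      simp [this]
    · intro j hj
      rw [if_neg (by rintro rfl; exact hn hj), mul_zero]

theorem defectOperator_eq_add (N : ℕ) (γ : ℝ) :
    defectOperator N γ = defectOperator N 0 + potentialOperator N γ := by
  ext w n
  rw [add_apply, lp.coeFn_add, Pi.add_apply, potentialOperator_apply,
    defectOperator_apply, defectOperator_apply, defectPotential_zero]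
  ring

/-- Off the real axis, the spectrum of `H_γ` consists of eigenvalues. -/
theorem isDefectEigenvalue_of_mem_spectrum {N : ℕ} {γ : ℝ} {z : ℂ} (hz : z.im ≠ 0)
    (hs : z ∈ spectrum ℂ (defectOperator N γ)) : IsDefectEigenvalue N γ z := by
  unfold IsDefectEigenvalue
  rw [defectOperator_eq_add] at hs ⊢
  exact hasEigenvalue_of_mem_spectrum_add_compact (isSelfAdjoint_defectOperator_zero N)
    (isCompactOperator_potentialOperator N γ) hz hs

/-! ### Chebyshev form of the solution inside the defect -/

open Polynomial Polynomial.Chebyshev in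
/-- Even-site values of the solution with `w 0 = z`, `w 1 = 1` inside the defect. -/
noncomputable def evenSite (a t z : ℂ) (m : ℕ) : ℂ :=
  z * (Chebyshev.T ℂ m).eval t + (a - z - t * z) * (Chebyshev.U ℂ ((m : ℤ) - 1)).eval t

open Polynomial Polynomial.Chebyshev in
/-- Odd-site values of the solution with `w 0 = z`, `w 1 = 1` inside the defect. -/
noncomputable def oddSite (b t z : ℂ) (m : ℕ) : ℂ :=
  (Chebyshev.T ℂ m).eval t + (t + 1 - b * z) * (Chebyshev.U ℂ ((m : ℤ) - 1)).eval t

open Polynomial in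
theorem chebyshev_eval_T_succ (t : ℂ) (m : ℕ) : (Chebyshev.T ℂ ((m + 1 : ℕ) : ℤ)).eval t =
    t * (Chebyshev.T ℂ m).eval t - (1 - t ^ 2) * (Chebyshev.U ℂ ((m : ℤ) - 1)).eval t := by
  have h := Chebyshev.T_eq_X_mul_T_sub_pol_U ℂ ((m : ℤ) - 1)
  rw [show (m : ℤ) - 1 + 2 = ((m + 1 : ℕ) : ℤ) by push_cast; ring,
    show (m : ℤ) - 1 + 1 = m by ring] at h
  rw [h]
  simp

open Polynomial in
theorem chebyshev_eval_U_succ (t : ℂ) (m : ℕ) : (Chebyshev.U ℂ (((m + 1 : ℕ) : ℤ) - 1)).eval t =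
    t * (Chebyshev.U ℂ ((m : ℤ) - 1)).eval t + (Chebyshev.T ℂ m).eval t := by
  have h := Chebyshev.U_eq_X_mul_U_add_T ℂ ((m : ℤ) - 1)
  rw [show (m : ℤ) - 1 + 1 = ((m + 1 : ℕ) : ℤ) - 1 by push_cast; ring] at h
  rw [h]
  simp

theorem evenSite_zero (a t z : ℂ) : evenSite a t z 0 = z := by simp [evenSite]

theorem oddSite_zero (b t z : ℂ) : oddSite b t z 0 = 1 := by simp [oddSite]

/-- The two-step transfer matrix has determinant `1` and trace `a * b - 2 = 2 * t`, hence the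
Chebyshev polynomials in `t`. -/
theorem evenSite_succ {a b t : ℂ} (h : a * b = 2 * t + 2) (z : ℂ) (m : ℕ) :
    evenSite a t z (m + 1) = a * oddSite b t z m - evenSite a t z m := by
  simp only [evenSite, oddSite, chebyshev_eval_T_succ, chebyshev_eval_U_succ]
  linear_combination z * (Polynomial.Chebyshev.U ℂ ((m : ℤ) - 1)).eval t * h

theorem oddSite_succ {a b t : ℂ} (h : a * b = 2 * t + 2) (z : ℂ) (m : ℕ) :
    oddSite b t z (m + 1) = b * evenSite a t z (m + 1) - oddSite b t z m := by
  simp only [evenSite, oddSite, chebyshev_eval_T_succ, chebyshev_eval_U_succ]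
  linear_combination -((Polynomial.Chebyshev.U ℂ ((m : ℤ) - 1)).eval t * t +
    (Polynomial.Chebyshev.T ℂ m).eval t) * h

open Polynomial in
/-- The matching condition at the right end of the defect, in terms of Chebyshev polynomials. -/
theorem oddSite_sub_evenSite {a b t z : ℂ} (h : (a + b) * z = 2 * (1 + z ^ 2)) (N : ℕ) :
    oddSite b t z N - z * evenSite a t z N = (1 - z ^ 2) * (Chebyshev.T ℂ N).eval t -
      (1 + z ^ 2) * (1 - t) * (Chebyshev.U ℂ ((N : ℤ) - 1)).eval t := by
  simp only [evenSite, oddSite]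
  linear_combination -(Chebyshev.U ℂ ((N : ℤ) - 1)).eval t * h

/-! ### Decay at infinity as boundary conditions -/

/-- A decaying solution of the free recurrence is a multiple of the decaying exponential. -/
theorem eq_mul_of_tendsto_zero {z : ℂ} (hz0 : z ≠ 0) (hz1 : ‖z‖ < 1) {f : ℕ → ℂ}
    (hf : ∀ n, f (n + 2) = (z + z⁻¹) * f (n + 1) - f n)
    (h0 : Filter.Tendsto f Filter.atTop (nhds 0)) : f 1 = z * f 0 := by
  -- The combination `f (n + 1) - z * f n` removes the decaying mode and leaves a multiple of `z⁻¹ ^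
  -- n`, so the weight `z ^ n` makes it constant.
  have hd : ∀ n, f 1 - z * f 0 = z ^ n * (f (n + 1) - z * f n) := by
    intro n
    induction n with
    | zero => simp
    | succ n ih =>
      rw [ih, hf n]
      field_simp
      ring
  have hlim : Filter.Tendsto (fun n => z ^ n * (f (n + 1) - z * f n)) Filter.atTop (nhds 0) := by
    have h1 := (tendsto_pow_atTop_nhds_zero_of_norm_lt_one hz1).mul
      (((Filter.tendsto_add_atTop_iff_nat 1).2 h0).sub (h0.const_mul z))
    simpa using h1
  have := tendsto_nhds_unique (tendsto_const_nhds.congr hd) hlim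
  exact sub_eq_zero.1 this

theorem defectPotential_of_odd {N m : ℕ} (γ : ℝ) (hm : m < N) :
    defectPotential N γ (2 * m + 1) = -(Complex.I * γ) := by
  rw [defectPotential, if_pos ⟨by omega, by omega⟩, Odd.neg_one_zpow ⟨(m : ℤ), rfl⟩]
  ring

theorem defectPotential_of_even {N m : ℕ} (γ : ℝ) (hm : m < N) :
    defectPotential N γ (2 * m + 2) = Complex.I * γ := by
  rw [defectPotential, if_pos ⟨by omega, by omega⟩, Even.neg_one_zpow ⟨(m : ℤ) + 1, by ring⟩]
  ring

theorem defectPotential_of_nonpos {N : ℕ} (γ : ℝ) {n : ℤ} (hn : n ≤ 0) :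
    defectPotential N γ n = 0 := if_neg (by omega)

theorem defectPotential_of_gt {N : ℕ} (γ : ℝ) {n : ℤ} (hn : 2 * (N : ℤ) < n) :
    defectPotential N γ n = 0 := if_neg (by omega)

theorem isDefectEigenvalue_iff_exists {N : ℕ} {γ : ℝ} {E : ℂ} : IsDefectEigenvalue N γ E ↔
    ∃ w : ℤ → ℂ, Memℓp w 2 ∧ w ≠ 0 ∧
      ∀ n, w (n + 1) + w (n - 1) + defectPotential N γ n * w n = E * w n := by
  constructor
  · intro h
    obtain ⟨v, hv⟩ := h.exists_hasEigenvector
    refine ⟨v, lp.memℓp v, fun h0 => hv.2 (lp.ext h0), fun n => ?_⟩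
    exact congrArg (fun u : lp (fun _ : ℤ => ℂ) 2 => u n) hv.apply_eq_smul
  · rintro ⟨w, hw, h0, h⟩
    refine Module.End.hasEigenvalue_of_hasEigenvector (x := (⟨w, hw⟩ : lp (fun _ : ℤ => ℂ) 2))
      ⟨Module.End.mem_eigenspace_iff.2 ?_, fun hh => h0 ?_⟩
    · apply lp.ext
      funext n
      exact h n
    · exact congrArg (fun u : lp (fun _ : ℤ => ℂ) 2 => (u : ℤ → ℂ)) hh

theorem memlp_two_tendsto_zero {w : ℤ → ℂ} (hw : Memℓp w 2) :
    Filter.Tendsto w Filter.cofinite (nhds 0) := by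
  have h := ((memℓp_gen_iff (by norm_num)).1 hw).tendsto_cofinite_zero
  rw [tendsto_zero_iff_norm_tendsto_zero]
  have h2 := (Real.continuous_sqrt.tendsto 0).comp h
  simpa [Function.comp_def, Real.sqrt_sq] using h2

section Recurrence

variable {N : ℕ} {γ : ℝ} {w : ℤ → ℂ} {E : ℂ}

theorem eq_zero_of_recurrence
    (h : ∀ n, w (n + 1) + w (n - 1) + defectPotential N γ n * w n = E * w n)
    (h0 : w 0 = 0) (h1 : w 1 = 0) : w = 0 := by
  have key : ∀ n : ℤ, w n = 0 ∧ w (n + 1) = 0 := by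
    intro n
    induction n using Int.induction_on with
    | zero => simpa using ⟨h0, h1⟩
    | succ i ih =>
      have := h (i + 1)
      rw [ih.2, show (i : ℤ) + 1 - 1 = i by ring, ih.1] at this
      exact ⟨ih.2, by simpa using this⟩
    | pred i ih =>
      have := h (-i)
      rw [ih.1, ih.2] at this
      refine ⟨by simpa using this, ?_⟩
      rw [sub_add_cancel]
      exact ih.1
  funext n
  exact (key n).1

theorem recurrence_left_boundary {z : ℂ} (hz0 : z ≠ 0) (hz1 : ‖z‖ < 1) (hw : Memℓp w 2)
    (h : ∀ n, w (n + 1) + w (n - 1) + defectPotential N γ n * w n = (z + z⁻¹) * w n) :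
    w 0 = z * w 1 := by
  have hinj : Function.Injective fun n : ℕ => (1 : ℤ) - n := fun a b hab => by
    simp only at hab; omega
  have ht := (memlp_two_tendsto_zero hw).comp (Nat.cofinite_eq_atTop ▸ hinj.tendsto_cofinite)
  -- The sequence starts at site `1`, inside the defect: the free recurrence at site `0` already
  -- involves it.
  have := eq_mul_of_tendsto_zero hz0 hz1 (f := fun n : ℕ => w (1 - n)) (fun n => ?_) ht
  · simpa using this
  · have := h (-n)
    rw [defectPotential_of_nonpos γ (by omega)] at this
    simp only [Nat.cast_add, Nat.cast_one, Nat.cast_ofNat]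
    rw [show (1 : ℤ) - (n + 2) = -n - 1 by ring, show (1 : ℤ) - (n + 1) = -n by ring,
      show (1 : ℤ) - n = -n + 1 by ring]
    linear_combination this

theorem recurrence_right_boundary {z : ℂ} (hz0 : z ≠ 0) (hz1 : ‖z‖ < 1) (hw : Memℓp w 2)
    (h : ∀ n, w (n + 1) + w (n - 1) + defectPotential N γ n * w n = (z + z⁻¹) * w n) :
    w (2 * N + 1) = z * w (2 * N) := by
  have hinj : Function.Injective fun n : ℕ => 2 * (N : ℤ) + n := fun a b hab => by
    simp only at hab; omega
  have ht := (memlp_two_tendsto_zero hw).comp (Nat.cofinite_eq_atTop ▸ hinj.tendsto_cofinite)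
  have := eq_mul_of_tendsto_zero hz0 hz1 (f := fun n : ℕ => w (2 * N + n)) (fun n => ?_) ht
  · simpa using this
  · have := h (2 * N + (n + 1))
    rw [defectPotential_of_gt γ (by omega)] at this
    simp only [Nat.cast_add, Nat.cast_one, Nat.cast_ofNat]
    rw [show 2 * (N : ℤ) + (n + 2) = 2 * N + (n + 1) + 1 by ring,
      show 2 * (N : ℤ) + n = 2 * N + (n + 1) - 1 by ring]
    linear_combination this

theorem recurrence_inside {z t : ℂ} (ht : 2 * t + 2 = E ^ 2 + γ ^ 2)
    (h : ∀ n, w (n + 1) + w (n - 1) + defectPotential N γ n * w n = E * w n)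
    (h0 : w 0 = z * w 1) (m : ℕ) (hm : m ≤ N) :
    w (2 * m) = w 1 * evenSite (E + Complex.I * γ) t z m ∧
      w (2 * m + 1) = w 1 * oddSite (E - Complex.I * γ) t z m := by
  have hab : (E + Complex.I * γ) * (E - Complex.I * γ) = 2 * t + 2 := by
    linear_combination -ht - γ ^ 2 * Complex.I_sq
  induction m with
  | zero => simp [evenSite_zero, oddSite_zero, h0, mul_comm]
  | succ m ih =>
    obtain ⟨i1, i2⟩ := ih (by omega)
    have e1 := h (2 * m + 1)
    rw [defectPotential_of_odd γ (by omega), add_sub_cancel_right, i1, i2] at e1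
    have r1 : w (2 * m + 2) = w 1 * evenSite (E + Complex.I * γ) t z (m + 1) := by
      rw [evenSite_succ hab, show (2 : ℤ) * m + 2 = 2 * m + 1 + 1 by ring]
      linear_combination e1
    have e2 := h (2 * m + 2)
    rw [defectPotential_of_even γ (by omega), show (2 : ℤ) * m + 2 - 1 = 2 * m + 1 by ring, i2,
      r1] at e2
    push_cast
    rw [show (2 : ℤ) * (m + 1) = 2 * m + 2 by ring]
    refine ⟨r1, ?_⟩
    rw [oddSite_succ hab]
    linear_combination e2

end Recurrence

/-! ### An explicit eigenvector from the matching condition -/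

/-- The solution that decays at `-∞`, continued by a decaying exponential to the right of the
defect. -/
noncomputable def decayingSequence (N : ℕ) (a b t z : ℂ) (n : ℤ) : ℂ :=
  if n ≤ 1 then z ^ (1 - n).toNat
  else if n ≤ 2 * N then
    if Even n then evenSite a t z (n / 2).toNat else oddSite b t z (n / 2).toNat
  else evenSite a t z N * z ^ (n - 2 * N).toNat

section DecayingSequence

variable {N : ℕ} {a b t z : ℂ}

theorem decayingSequence_left (m : ℕ) : decayingSequence N a b t z (1 - m) = z ^ m := by
  rw [decayingSequence, if_pos (by omega)]
  congr
  omega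

theorem decayingSequence_even (m : ℕ) (hm : m ≤ N) :
    decayingSequence N a b t z (2 * m) = evenSite a t z m := by
  rcases Nat.eq_zero_or_pos m with rfl | h0
  · simpa [evenSite_zero] using decayingSequence_left (N := N) (a := a) (b := b) (t := t) (z := z) 1
  · rw [decayingSequence, if_neg (by omega), if_pos (by omega), if_pos ⟨(m : ℤ), by ring⟩]
    congr
    omega

theorem decayingSequence_right (hN : 1 ≤ N) (m : ℕ) :
    decayingSequence N a b t z (2 * N + m) = evenSite a t z N * z ^ m := by
  rcases Nat.eq_zero_or_pos m with rfl | h0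
  · simpa using decayingSequence_even N le_rfl
  · rw [decayingSequence, if_neg (by omega), if_neg (by omega)]
    congr
    omega

/-- The matching condition enters only at `m = N`, where site `2 * N + 1` belongs to the right tail.
-/
theorem decayingSequence_odd (hN : 1 ≤ N) (h : oddSite b t z N = z * evenSite a t z N) (m : ℕ)
    (hm : m ≤ N) : decayingSequence N a b t z (2 * m + 1) = oddSite b t z m := by
  rcases Nat.eq_zero_or_pos m with rfl | h0
  · simpa [oddSite_zero] using decayingSequence_left (N := N) (a := a) (b := b) (t := t) (z := z) 0
  · rcases hm.lt_or_eq with hm | rfl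
    · rw [decayingSequence, if_neg (by omega), if_pos (by omega),
        if_neg (by rw [Int.not_even_iff_odd]; exact ⟨(m : ℤ), rfl⟩)]
      congr
      omega
    · have := decayingSequence_right (a := a) (b := b) (t := t) (z := z) hN 1
      rw [Nat.cast_one] at this
      rw [this, h]
      ring

theorem memlp_decayingSequence (hN : 1 ≤ N) (hz : ‖z‖ < 1) :
    Memℓp (decayingSequence N a b t z) 2 := by
  rw [memℓp_gen_iff (by norm_num)]
  have hg : Summable fun m : ℕ => (‖z‖ ^ 2) ^ m :=
    summable_geometric_of_lt_one (by positivity) (by nlinarith [norm_nonneg z])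
  simp only [ENNReal.toReal_ofNat, Real.rpow_ofNat]
  refine Summable.of_nat_of_neg ?_ ?_
  · rw [← summable_nat_add_iff (2 * N)]
    refine (hg.mul_left (‖evenSite a t z N‖ ^ 2)).congr fun m => ?_
    rw [show ((m + 2 * N : ℕ) : ℤ) = 2 * N + m by push_cast; ring, decayingSequence_right hN,
      norm_mul, norm_pow]
    ring
  · refine (hg.mul_left (‖z‖ ^ 2)).congr fun m => ?_
    rw [show -(m : ℤ) = 1 - (m + 1 : ℕ) by push_cast; ring, decayingSequence_left, norm_pow]
    ring

theorem decayingSequence_recurrence {γ : ℝ} {E : ℂ} (hN : 1 ≤ N) (hz0 : z ≠ 0)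
    (hE : E = z + z⁻¹) (ht : 2 * t + 2 = E ^ 2 + γ ^ 2) (ha : a = E + Complex.I * γ)
    (hb : b = E - Complex.I * γ) (h : oddSite b t z N = z * evenSite a t z N) (n : ℤ) :
    decayingSequence N a b t z (n + 1) + decayingSequence N a b t z (n - 1) +
      defectPotential N γ n * decayingSequence N a b t z n =
        E * decayingSequence N a b t z n := by
  have hab : a * b = 2 * t + 2 := by
    rw [ha, hb]
    linear_combination -ht - γ ^ 2 * Complex.I_sq
  rcases le_or_gt n 0 with hn | hn
  · obtain ⟨m, rfl⟩ : ∃ m : ℕ, n = -m := ⟨(-n).toNat, by omega⟩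
    rw [defectPotential_of_nonpos γ hn, show -(m : ℤ) + 1 = 1 - (m : ℕ) by ring,
      show -(m : ℤ) - 1 = 1 - (m + 2 : ℕ) by push_cast; ring,
      show -(m : ℤ) = 1 - (m + 1 : ℕ) by push_cast; ring]
    simp only [decayingSequence_left, hE]
    field_simp
    ring
  rcases le_or_gt n (2 * N) with hn' | hn'
  · rcases Int.even_or_odd' n with ⟨k, hk | hk⟩
    · obtain ⟨m, rfl⟩ : ∃ m : ℕ, k = m + 1 := ⟨(k - 1).toNat, by omega⟩
      have e : n = 2 * m + 2 := by rw [hk]; ring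
      have hm : m < N := by omega
      rw [e, defectPotential_of_even γ hm,
        show (2 : ℤ) * m + 2 + 1 = 2 * (m + 1 : ℕ) + 1 by push_cast; ring,
        show (2 : ℤ) * m + 2 - 1 = 2 * m + 1 by ring,
        show (2 : ℤ) * m + 2 = 2 * (m + 1 : ℕ) by push_cast; ring,
        decayingSequence_odd hN h _ hm, decayingSequence_odd hN h _ hm.le,
        decayingSequence_even _ hm, oddSite_succ hab, hb]
      ring
    · obtain ⟨m, rfl⟩ : ∃ m : ℕ, k = m := ⟨k.toNat, by omega⟩
      have hm : m < N := by omega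
      rw [hk, defectPotential_of_odd γ hm,
        show (2 : ℤ) * m + 1 + 1 = 2 * (m + 1 : ℕ) by push_cast; ring,
        show (2 : ℤ) * m + 1 - 1 = 2 * m by ring,
        decayingSequence_odd hN h _ hm.le, decayingSequence_even _ hm,
        decayingSequence_even _ hm.le, evenSite_succ hab, ha]
      ring
  · obtain ⟨m, rfl⟩ : ∃ m : ℕ, n = 2 * N + (m + 1 : ℕ) := ⟨(n - 2 * N - 1).toNat, by omega⟩
    rw [defectPotential_of_gt γ hn',
      show 2 * (N : ℤ) + (m + 1 : ℕ) + 1 = 2 * N + (m + 2 : ℕ) by push_cast; ring,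
      show 2 * (N : ℤ) + (m + 1 : ℕ) - 1 = 2 * N + (m : ℕ) by push_cast; ring]
    simp only [decayingSequence_right hN, hE]
    field_simp
    ring

end DecayingSequence

/-! ### The characteristic equation and its partial fractions -/

open Polynomial in
/-- The characteristic equation for the eigenvalues of `H_γ` off the continuous spectrum. -/
theorem isDefectEigenvalue_iff {N : ℕ} (hN : 1 ≤ N) {γ : ℝ} {z t : ℂ} (hz0 : z ≠ 0)
    (hz1 : ‖z‖ < 1) (ht : 2 * t + 2 = (z + z⁻¹) ^ 2 + γ ^ 2) :
    IsDefectEigenvalue N γ (z + z⁻¹) ↔ (1 - z ^ 2) * (Chebyshev.T ℂ N).eval t =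
      (1 + z ^ 2) * (1 - t) * (Chebyshev.U ℂ ((N : ℤ) - 1)).eval t := by
  set a := z + z⁻¹ + Complex.I * γ with ha
  set b := z + z⁻¹ - Complex.I * γ with hb
  have hsum : (a + b) * z = 2 * (1 + z ^ 2) := by
    rw [ha, hb]
    field_simp
    ring
  rw [← sub_eq_zero, ← oddSite_sub_evenSite (a := a) (b := b) hsum, sub_eq_zero,
    isDefectEigenvalue_iff_exists]
  constructor
  · rintro ⟨w, hw, hw0, h⟩
    have h0 := recurrence_left_boundary hz0 hz1 hw h
    have hr := recurrence_right_boundary hz0 hz1 hw h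
    have h1 : w 1 ≠ 0 := fun h1 => hw0 (eq_zero_of_recurrence h (by rw [h0, h1, mul_zero]) h1)
    obtain ⟨i1, i2⟩ := recurrence_inside ht h h0 N le_rfl
    rw [i1, i2] at hr
    exact mul_left_cancel₀ h1 (by linear_combination hr)
  · intro h
    refine ⟨decayingSequence N a b t z, memlp_decayingSequence hN hz1, fun hh => ?_,
      decayingSequence_recurrence hN hz0 rfl ht ha hb h⟩
    have h1 := decayingSequence_left (N := N) (a := a) (b := b) (t := t) (z := z) 0
    rw [hh] at h1
    simp at h1

/-- Excludes a common zero of `T_N` and `U_{N-1}`, and a zero of `T_N` at `t = 1`. -/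
theorem chebyshev_pell (t : ℂ) (m : ℕ) : (Polynomial.Chebyshev.T ℂ m).eval t ^ 2 +
    (1 - t ^ 2) * (Polynomial.Chebyshev.U ℂ ((m : ℤ) - 1)).eval t ^ 2 = 1 := by
  induction m with
  | zero => simp
  | succ m ih =>
    rw [chebyshev_eval_T_succ, chebyshev_eval_U_succ]
    linear_combination ih

theorem splits_chebyshev_T_real (N : ℕ) : (Polynomial.Chebyshev.T ℝ N).Splits := by
  rw [Polynomial.splits_iff_card_roots, Polynomial.Chebyshev.roots_T_real,
    Polynomial.Chebyshev.natDegree_T, Finset.card_val,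
    Finset.card_image_of_injOn]
  · simp
  · rw [← Finset.nodup_map_iff_injOn]
    exact Polynomial.Chebyshev.roots_T_real_nodup N

theorem gammaNk_sq (N k : ℕ) :
    gammaNk N k ^ 2 = 2 + 2 * Real.cos (Real.pi * (2 * (k : ℝ) - 1) / (2 * N)) := by
  rw [show Real.pi * (2 * (k : ℝ) - 1) / (2 * N) =
    2 * (Real.pi * (2 * (k : ℝ) - 1) / (4 * N)) by ring, Real.cos_two_mul, gammaNk]
  ring

theorem roots_chebyshev_T_complex (N : ℕ) : (Polynomial.Chebyshev.T ℂ N).roots =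
    (Finset.Icc 1 N).val.map fun k => ((gammaNk N k ^ 2 / 2 - 1 : ℝ) : ℂ) := by
  have hs := splits_chebyshev_T_real N
  rw [← Polynomial.Chebyshev.map_T (algebraMap ℝ ℂ), hs.roots_map, Polynomial.Chebyshev.roots_T_real,
    Finset.image_val_of_injOn (by
      rw [← Finset.nodup_map_iff_injOn]
      exact Polynomial.Chebyshev.roots_T_real_nodup N), Multiset.map_map,
    show Finset.Icc 1 N = (Finset.range N).map (addRightEmbedding 1) by
      rw [Finset.range_eq_Ico, Finset.map_add_right_Ico]; rfl,
    Finset.map_val, Multiset.map_map]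
  refine Multiset.map_congr rfl fun k _ => ?_
  simp only [Function.comp_apply, addRightEmbedding_apply, Complex.coe_algebraMap, gammaNk_sq]
  congr 1
  push_cast
  rw [show Real.pi * (2 * ((k : ℝ) + 1) - 1) / (2 * N) = (2 * k + 1) * Real.pi / (2 * N) by ring]
  ring

theorem chebyshev_T_ne_zero_iff (N : ℕ) (t : ℂ) : (Polynomial.Chebyshev.T ℂ N).eval t ≠ 0 ↔
    ∀ k ∈ Finset.Icc 1 N, 2 * t + 2 ≠ ((gammaNk N k ^ 2 : ℝ) : ℂ) := by
  have h0 : Polynomial.Chebyshev.T ℂ N ≠ 0 := by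
    intro h
    have := congrArg (Polynomial.eval 1) h
    simp at this
  have h := Polynomial.mem_roots h0 (a := t)
  rw [roots_chebyshev_T_complex, Multiset.mem_map, Polynomial.IsRoot.def] at h
  rw [Ne, ← h, not_exists]
  refine forall_congr' fun k => ?_
  rw [not_and]
  refine imp_congr Iff.rfl (not_congr ?_)
  push_cast
  constructor <;> intro h
  · linear_combination -2 * h
  · linear_combination -h / 2

/-- The weights in the partial fraction expansion of the characteristic function. -/
noncomputable def poleWeight (N k : ℕ) : ℝ := (4 - gammaNk N k ^ 2) / N

/-- Since `T_N' = N * U_{N-1}`, the quotient `U_{N-1} / T_N` is a logarithmic derivative divided by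
`N`. Writing `1 - t = (1 - t_k) - (t - t_k)` at each root `t_k` produces the weights and, from the
`N` equal remainders `-1 / N`, the constant `-1`. -/
theorem chebyshev_partial_fractions {N : ℕ} (hN : 1 ≤ N) {t : ℂ}
    (h : (Polynomial.Chebyshev.T ℂ N).eval t ≠ 0) :
    (1 - t) * (Polynomial.Chebyshev.U ℂ ((N : ℤ) - 1)).eval t =
      (Polynomial.Chebyshev.T ℂ N).eval t *
        (∑ k ∈ Finset.Icc 1 N,
          (poleWeight N k : ℂ) / (2 * t + 2 - ((gammaNk N k ^ 2 : ℝ) : ℂ)) - 1) := by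
  have hN0 : (N : ℂ) ≠ 0 := by exact_mod_cast (by omega : N ≠ 0)
  have hd := (IsAlgClosed.splits (Polynomial.Chebyshev.T ℂ N)).eval_derivative_eq_eval_mul_sum h
  rw [roots_chebyshev_T_complex, Multiset.map_map, Polynomial.Chebyshev.T_derivative_eq_U] at hd
  simp only [Polynomial.eval_mul, Int.cast_natCast, Polynomial.eval_natCast] at hd
  change (N : ℂ) * _ = _ * ∑ k ∈ Finset.Icc 1 N, _ at hd
  have hsum : ∑ k ∈ Finset.Icc 1 N,
      (poleWeight N k : ℂ) / (2 * t + 2 - ((gammaNk N k ^ 2 : ℝ) : ℂ)) - 1 =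
      (1 - t) / N * ∑ k ∈ Finset.Icc 1 N,
        ((fun z => 1 / (t - z)) ∘ fun k => ((gammaNk N k ^ 2 / 2 - 1 : ℝ) : ℂ)) k := by
    rw [Finset.mul_sum]
    have h1 : (1 : ℂ) = ∑ k ∈ Finset.Icc 1 N, 1 / (N : ℂ) := by
      simp [hN0]
    conv_lhs => rw [h1]
    rw [← Finset.sum_sub_distrib]
    refine Finset.sum_congr rfl fun k hk => ?_
    have hk := sub_ne_zero.2 ((chebyshev_T_ne_zero_iff N t).1 h k hk)
    obtain ⟨D, hD⟩ : ∃ D : ℂ, D = 2 * t + 2 - ((gammaNk N k ^ 2 : ℝ) : ℂ) := ⟨_, rfl⟩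
    have e : t - ((gammaNk N k ^ 2 / 2 - 1 : ℝ) : ℂ) = D / 2 := by
      rw [hD]
      push_cast
      ring
    rw [← hD] at hk ⊢
    simp only [Function.comp_apply, poleWeight, e]
    push_cast at hD ⊢
    field_simp
    linear_combination -hD
  rw [hsum]
  generalize ∑ k ∈ Finset.Icc 1 N,
    ((fun z => 1 / (t - z)) ∘ fun k => ((gammaNk N k ^ 2 / 2 - 1 : ℝ) : ℂ)) k = S at hd ⊢
  field_simp
  linear_combination (1 - t) * hd

/-- Division by `T_N` loses no solution: at a zero of `T_N` one of the factors on the right would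
vanish, which `‖z‖ < 1` or the Pell identity forbids. -/
theorem charEq_iff {N : ℕ} (hN : 1 ≤ N) {z t : ℂ} (hz : ‖z‖ < 1) :
    (1 - z ^ 2) * (Polynomial.Chebyshev.T ℂ N).eval t =
      (1 + z ^ 2) * (1 - t) * (Polynomial.Chebyshev.U ℂ ((N : ℤ) - 1)).eval t ↔
    (∀ k ∈ Finset.Icc 1 N, 2 * t + 2 ≠ ((gammaNk N k ^ 2 : ℝ) : ℂ)) ∧
      (1 + z ^ 2) * ∑ k ∈ Finset.Icc 1 N,
        (poleWeight N k : ℂ) / (2 * t + 2 - ((gammaNk N k ^ 2 : ℝ) : ℂ)) = 2 := by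
  rw [← chebyshev_T_ne_zero_iff]
  constructor
  · intro h
    have hT : (Polynomial.Chebyshev.T ℂ N).eval t ≠ 0 := by
      intro hT
      rw [hT, mul_zero, eq_comm, mul_eq_zero, mul_eq_zero] at h
      have hp := chebyshev_pell t N
      rw [hT] at hp
      rcases h with (h | h) | h
      · have : ‖z ^ 2‖ = 1 := by rw [eq_neg_of_add_eq_zero_right h]; simp
        rw [norm_pow] at this
        nlinarith [norm_nonneg z]
      · have ht : t = 1 := (sub_eq_zero.1 h).symm
        simp [ht] at hp
      · simp [h] at hp
    refine ⟨hT, ?_⟩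
    rw [mul_assoc, chebyshev_partial_fractions hN hT] at h
    exact mul_left_cancel₀ hT (by linear_combination -h)
  · rintro ⟨hT, h⟩
    rw [mul_assoc, chebyshev_partial_fractions hN hT]
    linear_combination -(Polynomial.Chebyshev.T ℂ N).eval t * h

theorem isDefectEigenvalue_iff_pole_sum {N : ℕ} (hN : 1 ≤ N) {γ : ℝ} {z : ℂ} (hz0 : z ≠ 0)
    (hz1 : ‖z‖ < 1) : IsDefectEigenvalue N γ (z + z⁻¹) ↔
    (∀ k ∈ Finset.Icc 1 N, (z + z⁻¹) ^ 2 + (γ : ℂ) ^ 2 ≠ ((gammaNk N k ^ 2 : ℝ) : ℂ)) ∧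
      (1 + z ^ 2) * ∑ k ∈ Finset.Icc 1 N,
        (poleWeight N k : ℂ) / ((z + z⁻¹) ^ 2 + (γ : ℂ) ^ 2 - ((gammaNk N k ^ 2 : ℝ) : ℂ)) = 2 := by
  have ht : 2 * (((z + z⁻¹) ^ 2 + (γ : ℂ) ^ 2) / 2 - 1) + 2 = (z + z⁻¹) ^ 2 + (γ : ℂ) ^ 2 := by ring
  rw [isDefectEigenvalue_iff hN hz0 hz1 ht, charEq_iff hN hz1, ht]

theorem gammaNk_angle {N k : ℕ} (h1 : 1 ≤ k) (hk : k ≤ N) :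
    0 < Real.pi * (2 * (k : ℝ) - 1) / (4 * N) ∧
      Real.pi * (2 * (k : ℝ) - 1) / (4 * N) < Real.pi / 2 := by
  have h1' : (1 : ℝ) ≤ k := by exact_mod_cast h1
  have hk' : (k : ℝ) ≤ N := by exact_mod_cast hk
  have hpi := Real.pi_pos
  constructor
  · apply div_pos <;> nlinarith
  · rw [div_lt_div_iff₀ (by linarith) two_pos]
    nlinarith

theorem gammaNk_pos {N k : ℕ} (h1 : 1 ≤ k) (hk : k ≤ N) : 0 < gammaNk N k := by
  obtain ⟨h, h'⟩ := gammaNk_angle h1 hk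
  exact mul_pos two_pos (Real.cos_pos_of_mem_Ioo ⟨by linarith [Real.pi_pos], h'⟩)

theorem gammaNk_lt {N j k : ℕ} (h1 : 1 ≤ j) (hjk : j < k) (hk : k ≤ N) :
    gammaNk N k < gammaNk N j := by
  obtain ⟨h, -⟩ := gammaNk_angle h1 (hjk.le.trans hk)
  obtain ⟨-, h'⟩ := gammaNk_angle (h1.trans hjk.le) hk
  have hN : (0 : ℝ) < N := by exact_mod_cast (by omega : 0 < N)
  have hjk' : (j : ℝ) < k := by exact_mod_cast hjk
  refine mul_lt_mul_of_pos_left (Real.cos_lt_cos_of_nonneg_of_le_pi_div_two h.le h'.le ?_) two_pos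
  have hpi := Real.pi_pos
  gcongr

theorem poleWeight_pos {N k : ℕ} (h1 : 1 ≤ k) (hk : k ≤ N) : 0 < poleWeight N k := by
  obtain ⟨h, h'⟩ := gammaNk_angle h1 hk
  have hN : (0 : ℝ) < N := by exact_mod_cast (by omega : 0 < N)
  have hc : gammaNk N k < 2 := by
    have := Real.cos_lt_cos_of_nonneg_of_le_pi_div_two le_rfl h'.le h
    rw [Real.cos_zero] at this
    unfold gammaNk
    linarith
  have := gammaNk_pos h1 hk
  exact div_pos (by nlinarith) hN

/-! ### Non-real eigenvalues lie on the imaginary axis -/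

/-- A non-real number is `z + z⁻¹` for some `z` in the punctured unit disc. -/
theorem exists_add_inv_eq {E : ℂ} (hE : E.im ≠ 0) : ∃ z : ℂ, z ≠ 0 ∧ ‖z‖ < 1 ∧ z + z⁻¹ = E := by
  obtain ⟨d, hd⟩ := IsAlgClosed.exists_pow_nat_eq (E ^ 2 - 4) two_pos
  have hmul : ((E + d) / 2) * ((E - d) / 2) = 1 := by linear_combination -hd / 4
  obtain ⟨z, hz, hzE⟩ : ∃ z : ℂ, z ≠ 0 ∧ z + z⁻¹ = E := by
    refine ⟨(E + d) / 2, left_ne_zero_of_mul_eq_one hmul, ?_⟩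
    rw [inv_eq_of_mul_eq_one_right hmul]
    ring
  rcases lt_trichotomy ‖z‖ 1 with h | h | h
  · exact ⟨z, hz, h, hzE⟩
  -- On the unit circle `z⁻¹` is the conjugate of `z`, so the sum would be real.
  · refine absurd ?_ hE
    rw [← hzE, Complex.add_im, Complex.inv_im, Complex.normSq_eq_norm_sq, h]
    simp
  · refine ⟨z⁻¹, inv_ne_zero hz, ?_, by rw [inv_inv, add_comm, hzE]⟩
    rw [norm_inv]
    exact inv_lt_one_of_one_lt₀ h

/-- With real poles and positive weights, each summand sends the upper half-plane to the lower one
and conversely. -/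
theorem im_mul_im_pole_sum_neg {N : ℕ} (hN : 1 ≤ N) {y : ℂ} (hy : y.im ≠ 0) :
    y.im * (∑ k ∈ Finset.Icc 1 N,
      (poleWeight N k : ℂ) / (y - ((gammaNk N k ^ 2 : ℝ) : ℂ))).im < 0 := by
  rw [Complex.im_sum, Finset.mul_sum]
  refine Finset.sum_neg (fun k hk => ?_) ⟨1, by simpa using hN⟩
  obtain ⟨h1, h2⟩ := Finset.mem_Icc.1 hk
  have hw := poleWeight_pos h1 h2
  have him : (y - ((gammaNk N k ^ 2 : ℝ) : ℂ)).im = y.im := by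
    rw [Complex.sub_im, Complex.ofReal_im, sub_zero]
  have hn : 0 < Complex.normSq (y - ((gammaNk N k ^ 2 : ℝ) : ℂ)) :=
    Complex.normSq_pos.2 fun h0 => hy (by rw [← him, h0, Complex.zero_im])
  rw [Complex.div_im, him, Complex.ofReal_im, zero_mul, zero_div, zero_sub, Complex.ofReal_re,
    mul_neg, neg_lt_zero, ← mul_div_assoc]
  have : 0 < y.im ^ 2 := by positivity
  exact div_pos (by nlinarith) hn

/-- Every non-real eigenvalue of `H_γ` is purely imaginary. -/
theorem sq_eq_neg_of_isDefectEigenvalue {N : ℕ} (hN : 1 ≤ N) {γ : ℝ} {E : ℂ} (hE : E.im ≠ 0)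
    (h : IsDefectEigenvalue N γ E) : ∃ s : ℝ, 0 < s ∧ E ^ 2 = -(s : ℂ) := by
  obtain ⟨z, hz0, hz1, rfl⟩ := exists_add_inv_eq hE
  obtain ⟨-, hR⟩ := (isDefectEigenvalue_iff_pole_sum hN hz0 hz1).1 h
  have him : ((z + z⁻¹) ^ 2).im = 0 := by
    by_contra hne
    set y := (z + z⁻¹) ^ 2 + (γ : ℂ) ^ 2 with hy
    have hyim : y.im = ((z + z⁻¹) ^ 2).im := by
      rw [hy, Complex.add_im, ← Complex.ofReal_pow, Complex.ofReal_im, add_zero]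
    have hneg := im_mul_im_pole_sum_neg hN (hyim ▸ hne)
    set r := ∑ k ∈ Finset.Icc 1 N, (poleWeight N k : ℂ) / (y - ((gammaNk N k ^ 2 : ℝ) : ℂ))
    have hz2 : ‖z ^ 2‖ < 1 := by rw [norm_pow]; nlinarith [norm_nonneg z]
    set u := z ^ 2 with hu
    have hu0 : u ≠ 0 := pow_ne_zero 2 hz0
    have hn0 : 0 < Complex.normSq u := Complex.normSq_pos.2 hu0
    have hn1 : Complex.normSq u < 1 := by
      rw [Complex.normSq_eq_norm_sq]; nlinarith [norm_nonneg u]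
    have hyu : y.im = u.im * (1 - (Complex.normSq u)⁻¹) := by
      have : (z + z⁻¹) ^ 2 = u + u⁻¹ + 2 := by
        rw [hu]; field_simp; ring
      rw [hyim, this]
      simp only [Complex.add_im, Complex.inv_im, Complex.im_ofNat]
      ring
    have hv : 1 + u ≠ 0 := fun h0 => by
      rw [h0, zero_mul] at hR
      norm_num at hR
    have hr : r = 2 * (1 + u)⁻¹ := by
      field_simp
      linear_combination hR
    have hrim : r.im = -(2 * u.im / Complex.normSq (1 + u)) := by
      rw [hr]
      simp [Complex.mul_im, Complex.inv_im]
      ring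
    rw [hyu, hrim] at hneg
    have hvn := Complex.normSq_pos.2 hv
    have hinv : 1 < (Complex.normSq u)⁻¹ := (one_lt_inv₀ hn0).2 hn1
    -- This is the product of the imaginary parts of `y` and `r = 2 / (1 + u)`: inside the disc both
    -- have the sign opposite to `u.im`, contradicting `hneg`.
    have : 0 ≤ u.im ^ 2 * ((Complex.normSq u)⁻¹ - 1) * (2 / Complex.normSq (1 + u)) := by
      have := sub_pos.2 hinv
      positivity
    apply hneg.not_ge
    refine this.trans_eq ?_
    ring
  set E := z + z⁻¹
  have h1 : E.re * E.im = 0 := by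
    rw [sq, Complex.mul_im] at him
    linarith
  have h2 : E.re = 0 := (mul_eq_zero.1 h1).resolve_right hE
  refine ⟨E.im ^ 2, by positivity, ?_⟩
  apply Complex.ext
  · simp [sq, h2]
  · rw [him, Complex.neg_im, Complex.ofReal_im, neg_zero]

/-- Characteristic equation on the imaginary axis. -/
theorem isDefectEigenvalue_imaginary_iff {N : ℕ} (hN : 1 ≤ N) {γ s : ℝ} {E : ℂ} (hs : 0 < s)
    (hE : E ^ 2 = -(s : ℂ)) : IsDefectEigenvalue N γ E ↔
    (∀ k ∈ Finset.Icc 1 N, γ ^ 2 - s ≠ gammaNk N k ^ 2) ∧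
      ∑ k ∈ Finset.Icc 1 N, poleWeight N k / (γ ^ 2 - s - gammaNk N k ^ 2) =
        1 + √(1 + 4 / s) := by
  obtain ⟨r, hr, rfl⟩ : ∃ r : ℝ, 0 < r ∧ s = r ^ 2 :=
    ⟨√s, Real.sqrt_pos.2 hs, (Real.sq_sqrt hs.le).symm⟩
  set p := √(r ^ 2 + 4) with hp
  have hp2 : p ^ 2 = r ^ 2 + 4 := Real.sq_sqrt (by positivity)
  have hrp : r < p := Real.lt_sqrt_of_sq_lt (by linarith)
  have hsqrt : √(1 + 4 / r ^ 2) = p / r := by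
    rw [hp, show 1 + 4 / r ^ 2 = (r ^ 2 + 4) / r ^ 2 by field_simp, Real.sqrt_div (by positivity),
      Real.sqrt_sq hr.le]
  -- For `E = ± i r` the root in the disc is `z = ∓ i q`, where `q⁻¹ - q = r`.
  obtain ⟨q, hq⟩ : ∃ q : ℝ, q = (p - r) / 2 := ⟨_, rfl⟩
  have hq0 : 0 < q := by rw [hq]; linarith
  have hq1 : q < 1 := by rw [hq]; nlinarith
  have hqr : 1 - q ^ 2 = q * r := by rw [hq]; nlinarith
  have hqrC : (1 : ℂ) - q ^ 2 = q * r := by exact_mod_cast hqr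
  have hrC : (r : ℂ) ≠ 0 := by exact_mod_cast hr.ne'
  have hqC : (q : ℂ) ≠ 0 := by exact_mod_cast hq0.ne'
  push_cast at hE
  set z : ℂ := -(q / r) * E with hz
  have hz2 : z ^ 2 = -(q : ℂ) ^ 2 := by
    rw [hz, mul_pow, hE]
    field_simp
  have hz0 : z ≠ 0 := fun h0 => by
    rw [h0] at hz2
    simp [hqC] at hz2
  have hz1 : ‖z‖ < 1 := by
    have : ‖z‖ ^ 2 = q ^ 2 := by
      rw [← norm_pow, hz2, norm_neg, norm_pow, Complex.norm_real, Real.norm_eq_abs, sq_abs]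
    nlinarith [norm_nonneg z]
  have hzE : z + z⁻¹ = E := by
    have hinv : z⁻¹ = E / (q * r) := by
      rw [inv_eq_iff_eq_inv, eq_comm, inv_eq_iff_eq_inv, ← mul_eq_one_iff_eq_inv₀ hz0, hz]
      field_simp
      linear_combination -hE
    rw [hinv, hz]
    field_simp
    linear_combination E * hqrC
  rw [← hzE, isDefectEigenvalue_iff_pole_sum hN hz0 hz1, hzE, hE, hz2]
  have hy : -(r : ℂ) ^ 2 + (γ : ℂ) ^ 2 = ((γ ^ 2 - r ^ 2 : ℝ) : ℂ) := by push_cast; ring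
  rw [hy, hsqrt]
  refine and_congr (forall₂_congr fun k _ => not_congr Complex.ofReal_inj) ?_
  have hsum : ∑ k ∈ Finset.Icc 1 N, (poleWeight N k : ℂ) /
      (((γ ^ 2 - r ^ 2 : ℝ) : ℂ) - ((gammaNk N k ^ 2 : ℝ) : ℂ)) =
      ((∑ k ∈ Finset.Icc 1 N, poleWeight N k / (γ ^ 2 - r ^ 2 - gammaNk N k ^ 2) : ℝ) : ℂ) := by
    push_cast
    rfl
  rw [hsum, show (1 : ℂ) + -(q : ℂ) ^ 2 = ((1 - q ^ 2 : ℝ) : ℂ) by push_cast; ring]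
  generalize ∑ k ∈ Finset.Icc 1 N, poleWeight N k / (γ ^ 2 - r ^ 2 - gammaNk N k ^ 2) = S
  have hval : (1 - q ^ 2) * (1 + p / r) = 2 := by
    rw [hqr, hq]
    field_simp
    nlinarith
  have hne : 1 - q ^ 2 ≠ 0 := by rw [hqr]; positivity
  constructor
  · intro h
    have h : (1 - q ^ 2) * S = 2 := by exact_mod_cast h
    exact mul_left_cancel₀ hne (h.trans hval.symm)
  · rintro rfl
    exact_mod_cast hval

/-- The right-hand side `1 + √(1 + 4 / s)` of the characteristic equation at `E² = -s`. -/
noncomputable def decayProfile (s : ℝ) : ℝ := 1 + √(1 + 4 / s)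

theorem decayProfile_pos (s : ℝ) : 0 < decayProfile s :=
  add_pos_of_pos_of_nonneg one_pos (Real.sqrt_nonneg _)

theorem decayProfile_strictAntiOn : StrictAntiOn decayProfile (Set.Ioi 0) := by
  intro a ha b hb hab
  have ha' : (0 : ℝ) < a := ha
  have hb' : (0 : ℝ) < b := hb
  refine add_lt_add_right (Real.sqrt_lt_sqrt (by positivity) ?_) 1
  gcongr

theorem decayProfile_continuousOn : ContinuousOn decayProfile (Set.Ioi 0) :=
  continuousOn_const.add (Real.continuous_sqrt.comp_continuousOn
    (continuousOn_const.add (continuousOn_const.div continuousOn_id fun _ hx => ne_of_gt hx)))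

theorem tendsto_decayProfile : Filter.Tendsto decayProfile (nhdsWithin 0 (Set.Ioi 0))
    Filter.atTop := by
  refine Filter.tendsto_atTop_add_const_left _ _ (Real.tendsto_sqrt_atTop.comp
    (Filter.tendsto_atTop_add_const_left _ _ ?_))
  exact (tendsto_inv_nhdsGT_zero.const_mul_atTop four_pos).congr fun s =>
    (div_eq_mul_inv _ _).symm

/-! ### One solution of the real equation in each gap -/

/-- A sum of simple poles at `Γ 1, …, Γ N`. -/
noncomputable def poleSum (N : ℕ) (c Γ : ℕ → ℝ) (y : ℝ) : ℝ :=
  ∑ k ∈ Finset.Icc 1 N, c k / (y - Γ k)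

/-- The interval between the `k`-th pole and the next larger one. -/
def poleGap (Γ : ℕ → ℝ) (k : ℕ) : Set ℝ := {y | Γ k < y ∧ ∀ j, 1 ≤ j → j < k → y < Γ j}

section PoleSum

variable {N : ℕ} {c Γ : ℕ → ℝ}

theorem poleGap_ne (hΓ : ∀ j k, 1 ≤ j → j < k → k ≤ N → Γ k < Γ j) {k j : ℕ} {y : ℝ}
    (hk : 1 ≤ k) (hj : j ∈ Finset.Icc 1 N) (hy : y ∈ poleGap Γ k) : y ≠ Γ j := by
  obtain ⟨h1, h2⟩ := Finset.mem_Icc.1 hj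
  rcases lt_trichotomy j k with h | rfl | h
  · exact (hy.2 j h1 h).ne
  · exact hy.1.ne'
  · exact ((hΓ k j hk h h2).trans hy.1).ne'

theorem poleSum_continuousAt {y : ℝ} (hy : ∀ k ∈ Finset.Icc 1 N, y ≠ Γ k) :
    ContinuousAt (poleSum N c Γ) y := by
  unfold poleSum
  refine tendsto_finsetSum _ fun k hk => ?_
  exact continuousAt_const.div (continuousAt_id.sub continuousAt_const) (sub_ne_zero.2 (hy k hk))

theorem poleSum_strictAntiOn (hc : ∀ k, 1 ≤ k → k ≤ N → 0 < c k)
    (hΓ : ∀ j k, 1 ≤ j → j < k → k ≤ N → Γ k < Γ j) {k : ℕ} (hk : 1 ≤ k) (hkN : k ≤ N) :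
    StrictAntiOn (poleSum N c Γ) (poleGap Γ k) := by
  intro a ha b hb hab
  refine Finset.sum_lt_sum_of_nonempty ⟨k, Finset.mem_Icc.2 ⟨hk, hkN⟩⟩ fun j hj => ?_
  obtain ⟨h1, h2⟩ := Finset.mem_Icc.1 hj
  have hcj := hc j h1 h2
  rcases lt_or_ge j k with h | h
  · have h3 := ha.2 j h1 h
    have h4 := hb.2 j h1 h
    rw [← neg_lt_neg_iff, ← div_neg, ← div_neg]
    exact div_lt_div_of_pos_left hcj (by linarith) (by linarith)
  · have h3 : Γ j < a := by
      rcases h.eq_or_lt with rfl | h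
      · exact ha.1
      · exact (hΓ k j hk h h2).trans ha.1
    exact div_lt_div_of_pos_left hcj (by linarith) (by linarith)

theorem poleSum_eq_add (k : ℕ) (hk : k ∈ Finset.Icc 1 N) : poleSum N c Γ =
    fun y => c k / (y - Γ k) + ∑ j ∈ (Finset.Icc 1 N).erase k, c j / (y - Γ j) := by
  funext y
  rw [poleSum, Finset.add_sum_erase _ (fun j => c j / (y - Γ j)) hk]

theorem continuousAt_sum_erase (hΓ : ∀ j k, 1 ≤ j → j < k → k ≤ N → Γ k < Γ j) {k : ℕ}
    (hk : k ∈ Finset.Icc 1 N) :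
    ContinuousAt (fun y => ∑ j ∈ (Finset.Icc 1 N).erase k, c j / (y - Γ j)) (Γ k) := by
  refine tendsto_finsetSum _ fun j hj => ?_
  obtain ⟨hne, hj⟩ := Finset.mem_erase.1 hj
  rw [Finset.mem_Icc] at hk hj
  refine continuousAt_const.div (continuousAt_id.sub continuousAt_const) (sub_ne_zero.2 ?_)
  rcases lt_or_gt_of_ne hne with h | h
  · exact (hΓ j k hj.1 h hk.2).ne
  · exact (hΓ k j hk.1 h hj.2).ne'

theorem tendsto_poleSum_right (hc : ∀ k, 1 ≤ k → k ≤ N → 0 < c k)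
    (hΓ : ∀ j k, 1 ≤ j → j < k → k ≤ N → Γ k < Γ j) {k : ℕ} (hk : k ∈ Finset.Icc 1 N) :
    Filter.Tendsto (poleSum N c Γ) (nhdsWithin (Γ k) (Set.Ioi (Γ k))) Filter.atTop := by
  rw [poleSum_eq_add k hk]
  have hck := hc k (Finset.mem_Icc.1 hk).1 (Finset.mem_Icc.1 hk).2
  refine Filter.Tendsto.atTop_add ?_
    ((continuousAt_sum_erase hΓ hk).tendsto.mono_left nhdsWithin_le_nhds)
  simp only [div_eq_mul_inv]
  refine Filter.Tendsto.const_mul_atTop hck (tendsto_inv_nhdsGT_zero.comp ?_)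
  refine tendsto_nhdsWithin_iff.2 ⟨?_, ?_⟩
  · have : ContinuousAt (fun y => y - Γ k) (Γ k) := by fun_prop
    simpa using this.tendsto.mono_left nhdsWithin_le_nhds
  · filter_upwards [self_mem_nhdsWithin] with y hy
    exact sub_pos.2 (Set.mem_Ioi.1 hy)

theorem tendsto_poleSum_left (hc : ∀ k, 1 ≤ k → k ≤ N → 0 < c k)
    (hΓ : ∀ j k, 1 ≤ j → j < k → k ≤ N → Γ k < Γ j) {k : ℕ} (hk : k ∈ Finset.Icc 1 N) :
    Filter.Tendsto (poleSum N c Γ) (nhdsWithin (Γ k) (Set.Iio (Γ k))) Filter.atBot := by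
  rw [poleSum_eq_add k hk]
  have hck := hc k (Finset.mem_Icc.1 hk).1 (Finset.mem_Icc.1 hk).2
  refine Filter.Tendsto.atBot_add ?_
    ((continuousAt_sum_erase hΓ hk).tendsto.mono_left nhdsWithin_le_nhds)
  simp only [div_eq_mul_inv]
  refine Filter.Tendsto.const_mul_atBot hck (tendsto_inv_nhdsLT_zero.comp ?_)
  refine tendsto_nhdsWithin_iff.2 ⟨?_, ?_⟩
  · have : ContinuousAt (fun y => y - Γ k) (Γ k) := by fun_prop
    simpa using this.tendsto.mono_left nhdsWithin_le_nhds
  · filter_upwards [self_mem_nhdsWithin] with y hy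
    exact sub_neg.2 (Set.mem_Iio.1 hy)

theorem tendsto_decayProfile_sub (x : ℝ) : Filter.Tendsto (fun y => decayProfile (x - y))
    (nhdsWithin x (Set.Iio x)) Filter.atTop := by
  refine tendsto_decayProfile.comp (tendsto_nhdsWithin_iff.2 ⟨?_, ?_⟩)
  · have : ContinuousAt (fun y => x - y) x := by fun_prop
    simpa using this.tendsto.mono_left nhdsWithin_le_nhds
  · filter_upwards [self_mem_nhdsWithin] with y hy
    exact sub_pos.2 (Set.mem_Iio.1 hy)

/-- Intermediate value argument on a gap truncated at `u`. -/
theorem exists_poleSum_eq_of_tendsto (hc : ∀ k, 1 ≤ k → k ≤ N → 0 < c k)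
    (hΓ : ∀ j k, 1 ≤ j → j < k → k ≤ N → Γ k < Γ j) {k : ℕ} (hk : k ∈ Finset.Icc 1 N)
    {x u : ℝ} (hu : Γ k < u) (hux : u ≤ x) (hgap : Set.Ioo (Γ k) u ⊆ poleGap Γ k)
    (hlim : Filter.Tendsto (fun y => decayProfile (x - y) - poleSum N c Γ y)
      (nhdsWithin u (Set.Iio u)) Filter.atTop) :
    ∃ y ∈ poleGap Γ k, y < x ∧ poleSum N c Γ y = decayProfile (x - y) := by
  have hcont : ContinuousOn (fun y => decayProfile (x - y) - poleSum N c Γ y)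
      (Set.Ioo (Γ k) u) := by
    refine ContinuousOn.sub (decayProfile_continuousOn.comp (by fun_prop) fun y hy =>
      sub_pos.2 (hy.2.trans_le hux)) fun y hy => ?_
    exact (poleSum_continuousAt fun j hj =>
      poleGap_ne hΓ (Finset.mem_Icc.1 hk).1 hj (hgap hy)).continuousWithinAt
  have hbot : Filter.Tendsto (fun y => decayProfile (x - y) - poleSum N c Γ y)
      (nhdsWithin (Γ k) (Set.Ioi (Γ k))) Filter.atBot := by
    have hx : Γ k < x := hu.trans_le hux
    have h1 : ContinuousAt (fun y => decayProfile (x - y)) (Γ k) :=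
      ContinuousAt.comp (f := fun y => x - y)
        (decayProfile_continuousOn.continuousAt (Ioi_mem_nhds (sub_pos.2 hx))) (by fun_prop)
    simp only [sub_eq_add_neg (decayProfile _)]
    exact (h1.tendsto.mono_left nhdsWithin_le_nhds).add_atBot
      (Filter.tendsto_neg_atTop_atBot.comp (tendsto_poleSum_right hc hΓ hk))
  have := isPreconnected_Ioo.intermediate_value_Iii
    (Filter.le_principal_iff.2 (Ioo_mem_nhdsGT hu))
    (Filter.le_principal_iff.2 (Ioo_mem_nhdsLT hu)) hcont hbot hlim
  obtain ⟨y, hy, hy0⟩ := this (Set.mem_univ 0)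
  exact ⟨y, hgap hy, hy.2.trans_le hux, (sub_eq_zero.1 hy0).symm⟩

/-- If `x` lies in the gap, truncate there: the decay profile blows up at `y = x`. Otherwise
truncate at the next pole, where the pole sum tends to `-∞` while the profile stays positive. -/
theorem exists_poleSum_eq (hc : ∀ k, 1 ≤ k → k ≤ N → 0 < c k)
    (hΓ : ∀ j k, 1 ≤ j → j < k → k ≤ N → Γ k < Γ j) {k : ℕ} (hk : 1 ≤ k) (hkN : k ≤ N)
    {x : ℝ} (hx : Γ k < x) :
    ∃ y ∈ poleGap Γ k, y < x ∧ poleSum N c Γ y = decayProfile (x - y) := by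
  have hkI := Finset.mem_Icc.2 ⟨hk, hkN⟩
  by_cases hgap : x ∈ poleGap Γ k
  · refine exists_poleSum_eq_of_tendsto hc hΓ hkI hx le_rfl
      (fun y hy => ⟨hy.1, fun j h1 h2 => hy.2.trans (hgap.2 j h1 h2)⟩) ?_
    have hcont : ContinuousAt (poleSum N c Γ) x :=
      poleSum_continuousAt fun j hj => poleGap_ne hΓ hk hj hgap
    simp only [sub_eq_add_neg (decayProfile _)]
    exact (tendsto_decayProfile_sub x).atTop_add
      (hcont.tendsto.neg.mono_left nhdsWithin_le_nhds)
  · have hk1 : 1 < k := by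
      by_contra h
      exact hgap ⟨hx, fun j h1 h2 => by omega⟩
    obtain ⟨m, rfl⟩ : ∃ m, k = m + 1 := ⟨k - 1, by omega⟩
    have hmI : m ∈ Finset.Icc 1 N := Finset.mem_Icc.2 ⟨by omega, by omega⟩
    have hle : ∀ j, 1 ≤ j → j < m + 1 → Γ m ≤ Γ j := fun j h1 h2 => by
      rcases (Nat.lt_succ_iff.1 h2).eq_or_lt with rfl | h
      · exact le_rfl
      · exact (hΓ j m h1 h (by omega)).le
    have hmx : Γ m ≤ x := by
      by_contra h
      exact hgap ⟨hx, fun j h1 h2 => (not_le.1 h).trans_le (hle j h1 h2)⟩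
    refine exists_poleSum_eq_of_tendsto hc hΓ hkI (hΓ m (m + 1) (by omega) (by omega) hkN) hmx
      (fun y hy => ⟨hy.1, fun j h1 h2 => hy.2.trans_le (hle j h1 h2)⟩) ?_
    refine Filter.tendsto_atTop_mono (fun y => ?_)
      (Filter.tendsto_neg_atBot_atTop.comp (tendsto_poleSum_left hc hΓ hmI))
    have := decayProfile_pos (x - y)
    simp only [Function.comp_apply]
    linarith

/-- Below all poles every term is nonpositive, so `y` exceeds some pole; the least index of such a
pole names the gap. -/
theorem exists_mem_poleGap (hc : ∀ k, 1 ≤ k → k ≤ N → 0 < c k) {y : ℝ}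
    (hy : ∀ k ∈ Finset.Icc 1 N, y ≠ Γ k) (hpos : 0 < poleSum N c Γ y) :
    ∃ k, 1 ≤ k ∧ k ≤ N ∧ y ∈ poleGap Γ k := by
  classical
  have hex : ∃ k, 1 ≤ k ∧ k ≤ N ∧ Γ k < y := by
    by_contra! h
    refine hpos.not_ge (Finset.sum_nonpos fun k hk => ?_)
    obtain ⟨h1, h2⟩ := Finset.mem_Icc.1 hk
    exact div_nonpos_of_nonneg_of_nonpos (hc k h1 h2).le (sub_nonpos.2 (h k h1 h2))
  obtain ⟨h1, h2, h3⟩ := Nat.find_spec hex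
  refine ⟨Nat.find hex, h1, h2, h3, fun j hj1 hj2 => ?_⟩
  have hjN : j ≤ N := hj2.le.trans h2
  have hm := Nat.find_min hex hj2
  exact lt_of_le_of_ne (not_lt.1 fun h => hm ⟨hj1, hjN, h⟩) (hy j (Finset.mem_Icc.2 ⟨hj1, hjN⟩))

/-- Both functions decrease, so `y' < y` and `x' - y' < x - y` are equivalent; together they would
give `x' < x`. The case `x = x'` is uniqueness, the general case yields the Lipschitz bound. -/
theorem poleSum_solution_mono (hc : ∀ k, 1 ≤ k → k ≤ N → 0 < c k)
    (hΓ : ∀ j k, 1 ≤ j → j < k → k ≤ N → Γ k < Γ j) {k : ℕ} (hk : 1 ≤ k) (hkN : k ≤ N)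
    {x x' y y' : ℝ} (hxx' : x ≤ x') (hy : y ∈ poleGap Γ k) (hyx : y < x)
    (h : poleSum N c Γ y = decayProfile (x - y)) (hy' : y' ∈ poleGap Γ k) (hyx' : y' < x')
    (h' : poleSum N c Γ y' = decayProfile (x' - y')) : y ≤ y' ∧ x - y ≤ x' - y' := by
  have hR := poleSum_strictAntiOn hc hΓ hk hkN
  have hD := decayProfile_strictAntiOn
  have e : y' < y ↔ x' - y' < x - y := by
    rw [← hR.lt_iff_gt hy hy', ← hD.lt_iff_gt (a := x - y) (sub_pos.2 hyx) (sub_pos.2 hyx'), h, h']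
  constructor
  · by_contra hlt
    have := e.1 (not_le.1 hlt)
    linarith
  · by_contra hlt
    have := e.2 (not_le.1 hlt)
    linarith

theorem poleGap_disjoint {j k : ℕ} {y : ℝ} (hj : 1 ≤ j) (hk : 1 ≤ k) (hyj : y ∈ poleGap Γ j)
    (hyk : y ∈ poleGap Γ k) : j = k := by
  rcases lt_trichotomy j k with h | h | h
  · exact absurd hyj.1 (hyk.2 j hj h).not_gt
  · exact h
  · exact absurd hyk.1 (hyj.2 k hk h).not_gt

open Classical in
/-- The `k`-th solution branch `s` of `poleSum (x - s) = decayProfile s`, extended by zero. -/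
noncomputable def branch (N : ℕ) (c Γ : ℕ → ℝ) (k : ℕ) (x : ℝ) : ℝ :=
  if h : ∃ y ∈ poleGap Γ k, y < x ∧ poleSum N c Γ y = decayProfile (x - y) then
    x - h.choose else 0

theorem branch_of_le {k : ℕ} {x : ℝ} (hx : x ≤ Γ k) : branch N c Γ k x = 0 := by
  rw [branch, dif_neg]
  rintro ⟨y, hy, hyx, -⟩
  linarith [hy.1]

theorem branch_spec (hc : ∀ k, 1 ≤ k → k ≤ N → 0 < c k)
    (hΓ : ∀ j k, 1 ≤ j → j < k → k ≤ N → Γ k < Γ j) {k : ℕ} (hk : 1 ≤ k) (hkN : k ≤ N)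
    {x : ℝ} (hx : Γ k < x) : 0 < branch N c Γ k x ∧ x - branch N c Γ k x ∈ poleGap Γ k ∧
      poleSum N c Γ (x - branch N c Γ k x) = decayProfile (branch N c Γ k x) := by
  have h := exists_poleSum_eq hc hΓ hk hkN hx
  obtain ⟨h1, h2, h3⟩ := h.choose_spec
  rw [branch, dif_pos h, sub_sub_cancel]
  exact ⟨sub_pos.2 h2, h1, h3⟩

theorem branch_unique (hc : ∀ k, 1 ≤ k → k ≤ N → 0 < c k)
    (hΓ : ∀ j k, 1 ≤ j → j < k → k ≤ N → Γ k < Γ j) {k : ℕ} (hk : 1 ≤ k) (hkN : k ≤ N)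
    {x s : ℝ} (hs : 0 < s) (hy : x - s ∈ poleGap Γ k)
    (h : poleSum N c Γ (x - s) = decayProfile s) : s = branch N c Γ k x := by
  have hx : Γ k < x := by linarith [hy.1]
  obtain ⟨h1, h2, h3⟩ := branch_spec hc hΓ hk hkN hx
  have e : ∀ s : ℝ, x - (x - s) = s := fun s => by ring
  have m1 := (poleSum_solution_mono hc hΓ hk hkN (le_refl x) hy (by linarith) (by rwa [e]) h2
    (by linarith) (by rwa [e])).1
  have m2 := (poleSum_solution_mono hc hΓ hk hkN (le_refl x) h2 (by linarith) (by rwa [e]) hy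
    (by linarith) (by rwa [e])).1
  linarith

/-- Both `s` and `x - s` are nondecreasing in `x`, so `s` is 1-Lipschitz. Across the pole the bound
comes from `x - s > Γ k`. -/
theorem branch_continuous (hc : ∀ k, 1 ≤ k → k ≤ N → 0 < c k)
    (hΓ : ∀ j k, 1 ≤ j → j < k → k ≤ N → Γ k < Γ j) {k : ℕ} (hk : 1 ≤ k) (hkN : k ≤ N) :
    Continuous (branch N c Γ k) := by
  have key : ∀ x x', x ≤ x' → branch N c Γ k x ≤ branch N c Γ k x' ∧
      branch N c Γ k x' - branch N c Γ k x ≤ x' - x := by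
    intro x x' hxx'
    rcases le_or_gt x' (Γ k) with hx' | hx'
    · rw [branch_of_le hx', branch_of_le (hxx'.trans hx')]
      exact ⟨le_rfl, by linarith⟩
    obtain ⟨h1', h2', h3'⟩ := branch_spec hc hΓ hk hkN hx'
    rcases le_or_gt x (Γ k) with hx | hx
    · rw [branch_of_le hx]
      exact ⟨h1'.le, by linarith [h2'.1]⟩
    obtain ⟨h1, h2, h3⟩ := branch_spec hc hΓ hk hkN hx
    have e : ∀ x s : ℝ, x - (x - s) = s := fun x s => by ring
    obtain ⟨m1, m2⟩ := poleSum_solution_mono hc hΓ hk hkN hxx' h2 (by linarith) (by rwa [e]) h2'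
      (by linarith) (by rwa [e])
    exact ⟨by linarith, by linarith⟩
  refine (LipschitzWith.of_le_add fun x x' => ?_).continuous
  rw [Real.dist_eq]
  rcases le_total x x' with h | h
  · linarith [(key x x' h).1, abs_nonneg (x - x')]
  · linarith [(key x' x h).2, le_abs_self (x - x')]

end PoleSum

/-! ### Eigenvalue branches of the defect operator -/

/-- The branch of `-E²` that bifurcates from zero at `|γ| = γ_{N,k}`. -/
noncomputable def energyBranch (N k : ℕ) (γ : ℝ) : ℝ :=
  branch N (poleWeight N) (fun j => gammaNk N j ^ 2) k (γ ^ 2)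

/-- The purely imaginary eigenvalue that bifurcates from zero at `|γ| = γ_{N,k}`. -/
noncomputable def imaginaryEnergy (N k : ℕ) (γ : ℝ) : ℂ := Complex.I * √(energyBranch N k γ)

section Branches

variable {N : ℕ}

theorem gammaNk_sq_lt (j k : ℕ) (h1 : 1 ≤ j) (hjk : j < k) (hk : k ≤ N) :
    gammaNk N k ^ 2 < gammaNk N j ^ 2 :=
  pow_lt_pow_left₀ (gammaNk_lt h1 hjk hk) (gammaNk_pos (h1.trans hjk.le) hk).le two_ne_zero

theorem gammaNk_sq_lt_sq_iff {k : ℕ} (h1 : 1 ≤ k) (hk : k ≤ N) {γ : ℝ} :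
    gammaNk N k ^ 2 < γ ^ 2 ↔ gammaNk N k < |γ| := by
  rw [sq_lt_sq, abs_of_pos (gammaNk_pos h1 hk)]

theorem energyBranch_pos {k : ℕ} (h1 : 1 ≤ k) (hk : k ≤ N) {γ : ℝ} (hγ : gammaNk N k < |γ|) :
    0 < energyBranch N k γ :=
  (branch_spec (Γ := fun j => gammaNk N j ^ 2) (fun _ => poleWeight_pos) gammaNk_sq_lt h1 hk
    ((gammaNk_sq_lt_sq_iff h1 hk).2 hγ)).1

theorem isDefectEigenvalue_iff_energyBranch (hN : 1 ≤ N) {γ s : ℝ} {E : ℂ} (hs : 0 < s)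
    (hE : E ^ 2 = -(s : ℂ)) : IsDefectEigenvalue N γ E ↔
      ∃ k, 1 ≤ k ∧ k ≤ N ∧ gammaNk N k < |γ| ∧ s = energyBranch N k γ := by
  rw [isDefectEigenvalue_imaginary_iff hN hs hE]
  constructor
  · rintro ⟨hne, h⟩
    obtain ⟨k, h1, hk, hgap⟩ := exists_mem_poleGap (N := N) (c := poleWeight N)
      (Γ := fun j => gammaNk N j ^ 2) (fun _ => poleWeight_pos) hne
      ((decayProfile_pos s).trans_eq h.symm)
    refine ⟨k, h1, hk, (gammaNk_sq_lt_sq_iff h1 hk).1 (hgap.1.trans (by linarith)),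
      branch_unique (fun _ => poleWeight_pos) gammaNk_sq_lt h1 hk hs hgap h⟩
  · rintro ⟨k, h1, hk, hγ, rfl⟩
    obtain ⟨-, h2, h3⟩ := branch_spec (Γ := fun j => gammaNk N j ^ 2) (fun _ => poleWeight_pos)
      gammaNk_sq_lt h1 hk ((gammaNk_sq_lt_sq_iff h1 hk).2 hγ)
    exact ⟨fun j hj => poleGap_ne gammaNk_sq_lt h1 hj h2, h3⟩

/-- Equal energies would place the same `γ ^ 2 - s` in two disjoint gaps. -/
theorem energyBranch_ne {j k : ℕ} (hj1 : 1 ≤ j) (hj : j ≤ N) (hk1 : 1 ≤ k) (hk : k ≤ N)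
    (hjk : j ≠ k) {γ : ℝ} (hγj : gammaNk N j < |γ|) (hγk : gammaNk N k < |γ|) :
    energyBranch N j γ ≠ energyBranch N k γ := by
  intro h
  have h1 := (branch_spec (Γ := fun j => gammaNk N j ^ 2) (fun _ => poleWeight_pos)
    gammaNk_sq_lt hj1 hj ((gammaNk_sq_lt_sq_iff hj1 hj).2 hγj)).2.1
  have h2 := (branch_spec (Γ := fun j => gammaNk N j ^ 2) (fun _ => poleWeight_pos)
    gammaNk_sq_lt hk1 hk ((gammaNk_sq_lt_sq_iff hk1 hk).2 hγk)).2.1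
  change γ ^ 2 - energyBranch N j γ ∈ _ at h1
  change γ ^ 2 - energyBranch N k γ ∈ _ at h2
  rw [h] at h1
  exact hjk (poleGap_disjoint hj1 hk1 h1 h2)

theorem imaginaryEnergy_im (k : ℕ) (γ : ℝ) :
    (imaginaryEnergy N k γ).im = √(energyBranch N k γ) := by
  simp [imaginaryEnergy]

theorem imaginaryEnergy_sq {k : ℕ} {γ : ℝ} (h : 0 < energyBranch N k γ) :
    imaginaryEnergy N k γ ^ 2 = -(energyBranch N k γ : ℂ) := by
  rw [imaginaryEnergy, mul_pow, Complex.I_sq, ← Complex.ofReal_pow, Real.sq_sqrt h.le]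
  ring

theorem starRingEnd_imaginaryEnergy (k : ℕ) (γ : ℝ) :
    starRingEnd ℂ (imaginaryEnergy N k γ) = -imaginaryEnergy N k γ := by
  simp [imaginaryEnergy]

theorem imaginaryEnergy_continuous {k : ℕ} (h1 : 1 ≤ k) (hk : k ≤ N) :
    Continuous (imaginaryEnergy N k) := by
  have h : Continuous (energyBranch N k) :=
    (branch_continuous (fun _ => poleWeight_pos) gammaNk_sq_lt h1 hk).comp (continuous_pow 2)
  unfold imaginaryEnergy
  fun_prop

theorem imaginaryEnergy_eq_zero {k : ℕ} {γ : ℝ} (h : |γ| = gammaNk N k) :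
    imaginaryEnergy N k γ = 0 := by
  rw [imaginaryEnergy, energyBranch, branch_of_le (by rw [← h, sq_abs])]
  simp

theorem exists_imaginaryEnergy_eq (hN : 1 ≤ N) {γ : ℝ} {z : ℂ} (hz : z.im ≠ 0)
    (h : IsDefectEigenvalue N γ z) : ∃ k, 1 ≤ k ∧ k ≤ N ∧ gammaNk N k < |γ| ∧
      (z = imaginaryEnergy N k γ ∨ z = starRingEnd ℂ (imaginaryEnergy N k γ)) := by
  obtain ⟨s, hs, hzs⟩ := sq_eq_neg_of_isDefectEigenvalue hN hz h
  obtain ⟨k, h1, hk, hγ, rfl⟩ := (isDefectEigenvalue_iff_energyBranch hN hs hzs).1 h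
  refine ⟨k, h1, hk, hγ, ?_⟩
  rw [starRingEnd_imaginaryEnergy]
  exact sq_eq_sq_iff_eq_or_eq_neg.1 (hzs.trans (imaginaryEnergy_sq hs).symm)

/-- Non-real eigenvalues of `H_γ` are isolated points of the spectrum. -/
theorem isIsolatedDefectEigenvalue_of_im_ne_zero (hN : 1 ≤ N) {γ : ℝ} {E : ℂ} (hE : E.im ≠ 0)
    (h : IsDefectEigenvalue N γ E) : IsIsolatedDefectEigenvalue N γ E := by
  refine ⟨h, ?_⟩
  -- A finite set containing all non-real spectrum; the spurious index `0` is harmless.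
  set S : Set ℂ := (fun k => imaginaryEnergy N k γ) '' Set.Iic N ∪
    (fun k => starRingEnd ℂ (imaginaryEnergy N k γ)) '' Set.Iic N with hS
  have hfin : (S \ {E}).Finite :=
    (((Set.finite_Iic N).image _).union ((Set.finite_Iic N).image _)).sdiff
  have h1 : ∀ᶠ z in nhds E, z ∉ S \ {E} :=
    hfin.isClosed.isOpen_compl.mem_nhds fun hmem => hmem.2 rfl
  have h2 : ∀ᶠ z in nhds E, z.im ≠ 0 := Complex.continuous_im.continuousAt.eventually_ne hE
  filter_upwards [nhdsWithin_le_nhds h1, nhdsWithin_le_nhds h2, self_mem_nhdsWithin]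
    with z hz1 hz2 hz3 hz
  obtain ⟨k, -, hk, -, hzk⟩ :=
    exists_imaginaryEnergy_eq hN hz2 (isDefectEigenvalue_of_mem_spectrum hz2 hz)
  exact hz1 ⟨hzk.imp (fun e => ⟨k, hk, e.symm⟩) (fun e => ⟨k, hk, e.symm⟩), hz3⟩

end Branches

theorem mainTheorem5 (N : ℕ) (hN : 1 ≤ N) :
    (∃ (E : ℕ → ℝ → ℂ) (D : ℕ → Set ℝ),
      (∀ k, 1 ≤ k → k ≤ N →
        -- the exceptional set: finitely many points on every compact interval
        (∀ a b : ℝ, (D k ∩ Set.Icc a b).Finite) ∧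
        -- the pair emerges from the point `0` of the continuous spectrum at `|γ| = γ_{N,k}`
        ContinuousOn (E k) {γ : ℝ | gammaNk N k ≤ |γ|} ∧
        (∀ γ : ℝ, |γ| = gammaNk N k → E k γ = 0) ∧
        -- and persists for all larger `|γ|`
        (∀ γ : ℝ, gammaNk N k < |γ| →
          IsIsolatedDefectEigenvalue N γ (E k γ) ∧
          IsIsolatedDefectEigenvalue N γ (starRingEnd ℂ (E k γ)) ∧
          (γ ∉ D k → (E k γ).im ≠ 0) ∧
          (γ ∈ D k → (E k γ).im = 0 ∧ IsDoubleSemisimple N γ (E k γ)))) ∧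
      -- the pairs are pairwise different
      (∀ j k, 1 ≤ j → j ≤ N → 1 ≤ k → k ≤ N → j ≠ k →
        ∀ γ : ℝ, gammaNk N j < |γ| → gammaNk N k < |γ| →
          E j γ ≠ E k γ ∧ E j γ ≠ starRingEnd ℂ (E k γ)) ∧
      -- and there are no other non-real eigenvalues
      (∀ (γ : ℝ) (z : ℂ), z.im ≠ 0 → IsDefectEigenvalue N γ z →
        ∃ k, 1 ≤ k ∧ k ≤ N ∧ gammaNk N k < |γ| ∧
          (z = E k γ ∨ z = starRingEnd ℂ (E k γ)))) ∧
    -- in particular, no non-real eigenvalues below the threshold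
    (∀ γ : ℝ, |γ| < gammaTilde N → ∀ z : ℂ, IsDefectEigenvalue N γ z → z.im = 0) := by
  refine ⟨⟨imaginaryEnergy N, fun _ => ∅, fun k h1 hk => ⟨fun a b => by simp,
    (imaginaryEnergy_continuous h1 hk).continuousOn, fun γ => imaginaryEnergy_eq_zero,
    fun γ hγ => ?_⟩, fun j k hj1 hj hk1 hk hjk γ hγj hγk => ?_,
    fun γ z hz h => exists_imaginaryEnergy_eq hN hz h⟩, fun γ hγ z h => ?_⟩
  · have hpos := energyBranch_pos h1 hk hγ
    have him : (imaginaryEnergy N k γ).im ≠ 0 := by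
      rw [imaginaryEnergy_im]
      exact (Real.sqrt_pos.2 hpos).ne'
    have hsq := imaginaryEnergy_sq hpos
    refine ⟨isIsolatedDefectEigenvalue_of_im_ne_zero hN him
      ((isDefectEigenvalue_iff_energyBranch hN hpos hsq).2 ⟨k, h1, hk, hγ, rfl⟩), ?_,
      fun _ => him, fun h => h.elim⟩
    rw [starRingEnd_imaginaryEnergy]
    exact isIsolatedDefectEigenvalue_of_im_ne_zero hN (by simpa using him)
      ((isDefectEigenvalue_iff_energyBranch hN hpos (by rw [neg_sq, hsq])).2
        ⟨k, h1, hk, hγ, rfl⟩)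
  · have hne := energyBranch_ne hj1 hj hk1 hk hjk hγj hγk
    have hpj := energyBranch_pos hj1 hj hγj
    have hpk := energyBranch_pos hk1 hk hγk
    have hsq : imaginaryEnergy N j γ ^ 2 ≠ imaginaryEnergy N k γ ^ 2 := by
      rw [imaginaryEnergy_sq hpj, imaginaryEnergy_sq hpk]
      exact fun h => hne (by exact_mod_cast neg_injective h)
    refine ⟨fun h => hsq (by rw [h]), fun h => hsq ?_⟩
    rw [h, starRingEnd_imaginaryEnergy, neg_sq]
  · by_contra hz
    obtain ⟨k, h1, hk, hk', -⟩ := exists_imaginaryEnergy_eq hN hz h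
    have hle : gammaNk N N ≤ gammaNk N k := by
      rcases hk.eq_or_lt with rfl | hlt
      · exact le_rfl
      · exact (gammaNk_lt h1 hlt le_rfl).le
    -- `gammaTilde N` unfolds to `gammaNk N N`, the smallest bifurcation value.
    exact (hγ.trans_le hle).not_gt hk'
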